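/- For $i \ge 0$ let $p_i$ be the $i$-th prime, counted from $p_0 = 2$, and for integers $n \ge -1$ let $$\Psi(n) = \prod_{i=0}^{n+1} \frac{p_i}{p_i - 1}.$$ For a real number $\delta > 0$ let $L_\delta$ be the smallest integer with $L_\delta \ge -1$ and $$\frac{p_{L_\delta+2}}{p_{L_\delta+2} - 1} \le 1 + \delta .$$ Then $L_\delta$ exists, and the pair $(L_\delta, \Psi(L_\delta))$ can be computed with time complexity $o(1/\delta)$ as $\delta \to 0$. Here time is counted on the real RAM: a random access machine with finitely many instructions, which works with integer words and with exact real numbers, each kind held in registers and in an indirectly addressed memory. An instruction loads an integer constant, adds, subtracts, multiplies or divides two integers (integer division) or two reals (exactly), reads or writes a memory cell, converts an integer to a real, branches on a comparison $a \le b$ of two integers or of two reals, or halts. Each instruction costs one unit of time; there are no real constants and no conversion from reals to integers. Precisely: there are a single program and functions $w, T : \mathbb{R}_{>0} \to \mathbb{N}$ with $w(\delta) = O(\log(1/\delta))$ and $T(\delta) = o(1/\delta)$ as $\delta \to 0^+$ such that for every real $\delta > 0$ the program, started with $\delta$ in a real register and zeros everywhere else, halts after at most $T(\delta)$ steps, without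 ever producing an integer $z$ with $|z| \ge 2^{w(\delta)}$, and outputs the integer $L_\delta$ and the real number $\Psi(L_\delta)$. -/

import Mathlib

open Filter Topology Asymptotics

/-- The `i`-th prime, counted from `0`: `p 0 = 2`, `p 1 = 3`, ... -/
noncomputable def nthPrime (i : ℕ) : ℕ := Nat.nth Nat.Prime i

/-- `Ψ(n) = ∏_{i = 0}^{n + 1} p_i / (p_i - 1)`, for integers `n ≥ -1`. -/
noncomputable def Psi (n : ℤ) : ℝ :=
  ∏ i ∈ Finset.range (n + 2).toNat, (nthPrime i : ℝ) / ((nthPrime i : ℝ) - 1)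

/-- The integers `L ≥ -1` with `p_{L+2} / (p_{L+2} - 1) ≤ 1 + δ`. -/
def admissibleIndices (δ : ℝ) : Set ℤ :=
  {L : ℤ | -1 ≤ L ∧
    (nthPrime (L + 2).toNat : ℝ) / ((nthPrime (L + 2).toNat : ℝ) - 1) ≤ 1 + δ}

/-! The real RAM: a random access machine with integer words of bounded size and exact real
numbers. Every instruction costs one unit of time. There is no rounding and no conversion from
reals to integers, and the only constants of a program are integers. -/

namespace RealRAM

/-- The four arithmetic operations. -/
inductive Op
  | add
  | sub
  | mul
  | div

/-- Arithmetic on integers. `div` is integer division (the floor, for a positive divisor);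
dividing by zero is a fault. -/
def Op.evalInt : Op → ℤ → ℤ → Option ℤ
  | .add, a, b => some (a + b)
  | .sub, a, b => some (a - b)
  | .mul, a, b => some (a * b)
  | .div, a, b => if b = 0 then none else some (a / b)

/-- Exact arithmetic on real numbers. Dividing by zero is a fault. -/
noncomputable def Op.evalReal : Op → ℝ → ℝ → Option ℝ
  | .add, a, b => some (a + b)
  | .sub, a, b => some (a - b)
  | .mul, a, b => some (a * b)
  | .div, a, b => if b = 0 then none else some (a / b)

/-- Instructions. The machine has integer registers, real registers, an integer memory and a real
memory; registers are named in the program, memory cells are addressed through the content of an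
integer register. -/
inductive Instr
  /-- integer register `d` receives the constant `c` -/
  | const (d : ℕ) (c : ℤ)
  /-- integer register `d` receives `op` of the integer registers `a` and `b` -/
  | intOp (op : Op) (d a b : ℕ)
  /-- integer register `d` receives the integer memory cell addressed by integer register `a` -/
  | intLoad (d a : ℕ)
  /-- the integer memory cell addressed by integer register `a` receives integer register `b` -/
  | intStore (a b : ℕ)
  /-- real register `d` receives the integer register `a` -/
  | cast (d a : ℕ)
  /-- real register `d` receives `op` of the real registers `a` and `b` -/
  | realOp (op : Op) (d a b : ℕ)
  /-- real register `d` receives the real memory cell addressed by integer register `a` -/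
  | realLoad (d a : ℕ)
  /-- the real memory cell addressed by integer register `a` receives real register `b` -/
  | realStore (a b : ℕ)
  /-- jump to line `l` if integer register `a` is at most integer register `b` -/
  | intJumpLE (a b l : ℕ)
  /-- jump to line `l` if real register `a` is at most real register `b` -/
  | realJumpLE (a b l : ℕ)
  /-- stop -/
  | halt

/-- A program is a finite list of instructions; its lines are numbered from `0`. -/
abbrev Program := List Instr

/-- A configuration: the program counter, the registers, and the memory. -/
structure State where
  pc : ℕ
  intReg : ℕ → ℤ
  realReg : ℕ → ℝ
  intMem : ℕ → ℤ
  realMem : ℕ → ℝ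

/-- The initial configuration on input `x`: real register `0` holds `x`, all else is zero. -/
def init (x : ℝ) : State where
  pc := 0
  intReg := fun _ => 0
  realReg := fun i => if i = 0 then x else 0
  intMem := fun _ => 0
  realMem := fun _ => 0

/-- Move on to the next line. -/
def State.next (s : State) : State := { s with pc := s.pc + 1 }

/-- Write `z` to integer register `d` of a machine with word size `w`: a fault unless
`|z| < 2 ^ w`. -/
def State.writeInt (s : State) (w d : ℕ) (z : ℤ) : Option State :=
  if |z| < 2 ^ w then some { s with intReg := Function.update s.intReg d z } else none

/-- Write `x` to real register `d`. -/
def State.writeReal (s : State) (d : ℕ) (x : ℝ) : State :=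
  { s with realReg := Function.update s.realReg d x }

/-- The address held by integer register `a`; a negative address is a fault. -/
def State.address (s : State) (a : ℕ) : Option ℕ :=
  if 0 ≤ s.intReg a then some (s.intReg a).toNat else none

/-- The effect of one instruction on a machine with word size `w`. The value `none` means that no
step is possible: either there was a fault, or the instruction is `halt`. -/
noncomputable def Instr.exec (w : ℕ) (s : State) : Instr → Option State
  | .const d c => (s.writeInt w d c).map State.next
  | .intOp op d a b =>
      (op.evalInt (s.intReg a) (s.intReg b)).bind fun z => (s.writeInt w d z).map State.next
  | .intLoad d a =>
      (s.address a).bind fun m => (s.writeInt w d (s.intMem m)).map State.next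
  | .intStore a b =>
      (s.address a).map fun m =>
        State.next { s with intMem := Function.update s.intMem m (s.intReg b) }
  | .cast d a => some (s.writeReal d (s.intReg a : ℝ)).next
  | .realOp op d a b =>
      (op.evalReal (s.realReg a) (s.realReg b)).map fun x => (s.writeReal d x).next
  | .realLoad d a => (s.address a).map fun m => (s.writeReal d (s.realMem m)).next
  | .realStore a b =>
      (s.address a).map fun m =>
        State.next { s with realMem := Function.update s.realMem m (s.realReg b) }
  | .intJumpLE a b l => some (if s.intReg a ≤ s.intReg b then { s with pc := l } else s.next)
  | .realJumpLE a b l => some (if s.realReg a ≤ s.realReg b then { s with pc := l } else s.next)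
  | .halt => none

/-- One step of the program `P`; running out of the program is a fault. -/
noncomputable def step (P : Program) (w : ℕ) (s : State) : Option State :=
  P[s.pc]?.bind (Instr.exec w s)

/-- `t` steps of the program `P`. -/
noncomputable def run (P : Program) (w : ℕ) : ℕ → State → Option State
  | 0, s => some s
  | t + 1, s => (step P w s).bind (run P w t)

/-- On input `x`, with word size `w`, the program `P` halts without fault after at most `t` steps,
with the integer `L` in integer register `0` and the real number `y` in real register `0`. -/
def ComputesWithin (P : Program) (w t : ℕ) (x : ℝ) (L : ℤ) (y : ℝ) : Prop :=
  ∃ n ≤ t, ∃ s : State, run P w n (init x) = some s ∧ P[s.pc]? = some Instr.halt ∧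
    s.intReg 0 = L ∧ s.realReg 0 = y

end RealRAM

/-! Put `n = ⌈1/δ⌉`. A natural number `c` satisfies `1 + δ ≤ c * δ` exactly when `n < c`, so a prime
satisfies the inequality defining `L_δ` exactly when it exceeds `n`. Since `L ≥ -1` excludes the
prime 2, the index sought is the number of primes up to `max n 2`, minus two, and `Ψ` is the product
over these primes (`isLeast_admissible`, `Psi_cnt`). The machine cannot round `1/δ`, but this
inequality lets it compare any integer with `n`.

Euler's sieve crosses out every composite `c` once, as `q * i` with `q = c.minFac`, so its cost is
linear in the number of integers it handles. It is restricted here to the `k`-rough numbers, those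
prime to `k!`. Their density `φ(k!)/k!` is the product of `1 - 1/p` over the primes `p ≤ k`, which
tends to zero because the sum of `1/p` diverges (`tendsto_totient_factorial_div`). A table of gaps
modulo `k!` leads from one rough number to the next; it is built in `O(k * k!)` steps. Choosing `k`
largest with `k!^3 ≤ n` (or `k = 2` for small `n`) makes this `O(n/k)`, and still `k → ∞` as `n → ∞`
(`time_le`, `exists_time_le`).

For correctness, `Crossed` describes the marks at each stage of the sieve. For the running time,
each crossing enlarges a set of rough numbers by one element and each candidate is a new rough
number, so both totals are at most the number of rough numbers up to `n` (`Reach.sieving`,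
`Reach.total`). -/

namespace RealRAM

/-- Within at most `t` steps of `P`, the machine reaches from `s` a state with property `Q`. -/
def Reach (P : Program) (w : ℕ) (s : State) (t : ℕ) (Q : State → Prop) : Prop :=
  ∃ m ≤ t, ∃ final, run P w m s = some final ∧ Q final

/-- The state with natural numbers `l` in the integer registers, real numbers `r` in the real
registers, natural numbers `M` in the integer memory and real memory `X`. -/
def St (pc : ℕ) (l : List ℕ) (r : List ℝ) (M : ℕ → ℕ) (X : ℕ → ℝ) : State where
  pc := pc
  intReg := fun i => (l.getD i 0 : ℕ)
  realReg := fun i => r.getD i 0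
  intMem := fun a => (M a : ℕ)
  realMem := X

/-! ### Symbolic execution: one rule per kind of instruction. -/

section Rules

variable {P : Program} {w : ℕ} {s : State} {t u : ℕ} {Q R : State → Prop}

theorem execute_add (P : Program) (w m n : ℕ) (s : State) :
    run P w (m + n) s = (run P w m s).bind (run P w n) := by
  induction m generalizing s with
  | zero => simp [run]
  | succ m ih =>
    rw [Nat.succ_add]
    simp only [run]
    cases step P w s with
    | none => rfl
    | some s' => simpa using ih s'

theorem Reach.done (h : Q s) : Reach P w s t Q := ⟨0, Nat.zero_le _, s, rfl, h⟩

theorem Reach.mono_time (h : Reach P w s t Q) (htu : t ≤ u) : Reach P w s u Q := by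
  obtain ⟨m, hm, h⟩ := h
  exact ⟨m, hm.trans htu, h⟩

theorem Reach.trans (h : Reach P w s t Q) (h' : ∀ s', Q s' → Reach P w s' u R) :
    Reach P w s (t + u) R := by
  obtain ⟨m, hm, s', hs', hQ⟩ := h
  obtain ⟨m', hm', s'', hs'', hR⟩ := h' s' hQ
  exact ⟨m + m', add_le_add hm hm', s'', by rw [execute_add, hs']; exact hs'', hR⟩

theorem Reach.step {s' : State} (hs : step P w s = some s') (h : Reach P w s' t Q) :
    Reach P w s (t + 1) Q := by
  obtain ⟨m, hm, s'', hs'', hQ⟩ := h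
  exact ⟨m + 1, by omega, s'', by simp only [run, hs]; exact hs'', hQ⟩

theorem update_getD {α : Type*} (l : List α) (e : α) (d : ℕ) (hd : Nat.blt d l.length = true)
    (z : α) : Function.update (fun i => l.getD i e) d z = fun i => (l.set d z).getD i e := by
  have hd' : d < l.length := by simpa [Nat.blt] using hd
  funext i
  by_cases h : i = d
  · subst h; simp [hd']
  · simp [h, List.getElem?_set_ne (Ne.symm h)]

theorem update_getD_cast (l : List ℕ) (d : ℕ) (hd : Nat.blt d l.length = true) (z : ℕ) :
    Function.update (fun i => ((l.getD i 0 : ℕ) : ℤ)) d (z : ℤ) =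
      fun i => (((l.set d z).getD i 0 : ℕ) : ℤ) := by
  have h := update_getD l 0 d hd z
  funext i
  have hi := congrFun h i
  by_cases h : i = d
  · subst h; simp only [Function.update_self] at hi ⊢; rw [← hi]
  · rw [Function.update_of_ne h] at hi ⊢; rw [← hi]

variable {pc : ℕ} {l : List ℕ} {r : List ℝ} {M : ℕ → ℕ} {X : ℕ → ℝ} {d a b : ℕ}

theorem St_writeInt (hd : Nat.blt d l.length = true) (z : ℕ) (hw : z < 2 ^ w) :
    ((St pc l r M X).writeInt w d (z : ℤ)).map State.next
      = some (St (pc + 1) (l.set d z) r M X) := by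
  have : |(z : ℤ)| < 2 ^ w := by
    rw [Nat.abs_cast]; exact_mod_cast hw
  simp only [State.writeInt, this, if_true, Option.map_some, State.next, St]
  rw [update_getD_cast l d hd z]

theorem St_writeReal (hd : Nat.blt d r.length = true) (z : ℝ) :
    ((St pc l r M X).writeReal d z).next = St (pc + 1) l (r.set d z) M X := by
  simp only [State.writeReal, State.next, St]
  rw [update_getD r 0 d hd z]

theorem St_address : (St pc l r M X).address a = some (l.getD a 0) := by
  simp [State.address, St]

/-- In this and the following rules the side conditions on the program line and on register contents
default to `rfl`. A run is thus executed symbolically, and what remains to prove is word bounds,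
nonzero divisors, loads, subtractions and outcomes of comparisons. -/
theorem Reach.const (z : ℕ) (hw : z < 2 ^ w) (h : Reach P w (St (pc + 1) (l.set d z) r M X) t Q)
    (hP : P[pc]? = some (.const d z) := by rfl) (hd : Nat.blt d l.length = true := by rfl) :
    Reach P w (St pc l r M X) (t + 1) Q := by
  refine Reach.step ?_ h
  show (P[pc]?).bind _ = _
  rw [hP]
  exact St_writeInt hd z hw

theorem Reach.intOp {op : Op} (z : ℕ)
    (hz : op.evalInt (l.getD a 0 : ℕ) (l.getD b 0 : ℕ) = some (z : ℤ)) (hw : z < 2 ^ w)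
    (h : Reach P w (St (pc + 1) (l.set d z) r M X) t Q)
    (hP : P[pc]? = some (.intOp op d a b)) (hd : Nat.blt d l.length = true) :
    Reach P w (St pc l r M X) (t + 1) Q := by
  refine Reach.step ?_ h
  show (P[pc]?).bind _ = _
  rw [hP]
  show (op.evalInt (l.getD a 0 : ℕ) (l.getD b 0 : ℕ)).bind _ = _
  rw [hz]
  exact St_writeInt hd z hw

theorem Reach.add (z : ℕ) (hw : z < 2 ^ w) (h : Reach P w (St (pc + 1) (l.set d z) r M X) t Q)
    (hP : P[pc]? = some (.intOp .add d a b) := by rfl)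
    (hz : l.getD a 0 + l.getD b 0 = z := by rfl)
    (hd : Nat.blt d l.length = true := by rfl) :
    Reach P w (St pc l r M X) (t + 1) Q :=
  Reach.intOp z (by simp only [Op.evalInt, ← hz]; push_cast; rfl) hw h hP hd

theorem Reach.mul (z : ℕ) (hw : z < 2 ^ w) (h : Reach P w (St (pc + 1) (l.set d z) r M X) t Q)
    (hP : P[pc]? = some (.intOp .mul d a b) := by rfl)
    (hz : l.getD a 0 * l.getD b 0 = z := by rfl)
    (hd : Nat.blt d l.length = true := by rfl) :
    Reach P w (St pc l r M X) (t + 1) Q :=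
  Reach.intOp z (by simp only [Op.evalInt, ← hz]; push_cast; rfl) hw h hP hd

theorem Reach.sub {x y : ℕ} (z : ℕ) (hz : x = z + y) (hw : z < 2 ^ w)
    (h : Reach P w (St (pc + 1) (l.set d z) r M X) t Q)
    (hP : P[pc]? = some (.intOp .sub d a b) := by rfl)
    (hx : l.getD a 0 = x := by rfl) (hy : l.getD b 0 = y := by rfl)
    (hd : Nat.blt d l.length = true := by rfl) :
    Reach P w (St pc l r M X) (t + 1) Q :=
  Reach.intOp z (by simp only [Op.evalInt, hx, hy, hz]; push_cast; simp) hw h hP hd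

/-- The output index may be `-1`, the only negative integer that occurs, so the resulting state need
not have the form `St`. -/
theorem Reach.sub_last {x y : ℕ} (hw : |(x : ℤ) - (y : ℤ)| < 2 ^ w)
    (h : Reach P w { St (pc + 1) l r M X with
      intReg := Function.update (St pc l r M X).intReg d ((x : ℤ) - (y : ℤ)) } t Q)
    (hP : P[pc]? = some (.intOp .sub d a b) := by rfl)
    (hx : l.getD a 0 = x := by rfl) (hy : l.getD b 0 = y := by rfl) :
    Reach P w (St pc l r M X) (t + 1) Q := by
  subst hx hy
  refine Reach.step ?_ h
  show (P[pc]?).bind _ = _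
  rw [hP]
  show (State.writeInt _ w d (((l.getD a 0 : ℕ) : ℤ) - ((l.getD b 0 : ℕ) : ℤ))).map State.next = _
  rw [State.writeInt, if_pos hw]
  rfl

theorem Reach.div {y : ℕ} (z : ℕ) (hb : y ≠ 0) (hw : z < 2 ^ w)
    (h : Reach P w (St (pc + 1) (l.set d z) r M X) t Q)
    (hP : P[pc]? = some (.intOp .div d a b) := by rfl)
    (hy : l.getD b 0 = y := by rfl)
    (hz : l.getD a 0 / l.getD b 0 = z := by rfl)
    (hd : Nat.blt d l.length = true := by rfl) :
    Reach P w (St pc l r M X) (t + 1) Q :=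
  Reach.intOp z (by
    simp only [Op.evalInt, ← hz]
    rw [if_neg (by rw [hy]; exact_mod_cast hb)]
    push_cast; rfl) hw h hP hd

theorem Reach.intLoad {m : ℕ} (z : ℕ) (hz : M m = z) (hw : z < 2 ^ w)
    (h : Reach P w (St (pc + 1) (l.set d z) r M X) t Q)
    (hP : P[pc]? = some (.intLoad d a) := by rfl)
    (hm : l.getD a 0 = m := by rfl)
    (hd : Nat.blt d l.length = true := by rfl) :
    Reach P w (St pc l r M X) (t + 1) Q := by
  refine Reach.step ?_ h
  show (P[pc]?).bind _ = _
  rw [hP]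
  simp only [Option.bind_some, Instr.exec, St_address, hm, ← hz]
  exact St_writeInt hd _ (hz ▸ hw)

theorem Reach.intStore (m z : ℕ)
    (h : Reach P w (St (pc + 1) l r (Function.update M m z) X) t Q)
    (hP : P[pc]? = some (.intStore a b) := by rfl)
    (hm : l.getD a 0 = m := by rfl) (hz : l.getD b 0 = z := by rfl) :
    Reach P w (St pc l r M X) (t + 1) Q := by
  refine Reach.step ?_ h
  show (P[pc]?).bind _ = _
  rw [hP]
  simp only [Option.bind_some, Instr.exec, St_address, hm, Option.map_some]
  simp only [State.next, St, hz, Option.some.injEq, State.mk.injEq, true_and,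
    and_true]
  funext i
  by_cases h : i = m
  · subst h; simp
  · simp [h]

theorem Reach.cast (x : ℕ) (h : Reach P w (St (pc + 1) l (r.set d (x : ℝ)) M X) t Q)
    (hP : P[pc]? = some (.cast d a) := by rfl)
    (hx : l.getD a 0 = x := by rfl)
    (hd : Nat.blt d r.length = true := by rfl) :
    Reach P w (St pc l r M X) (t + 1) Q := by
  refine Reach.step ?_ h
  show (P[pc]?).bind _ = _
  rw [hP, ← St_writeReal hd, ← hx]
  simp [Instr.exec, St]

theorem Reach.realOp {op : Op} (z : ℝ) (hz : op.evalReal (r.getD a 0) (r.getD b 0) = some z)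
    (h : Reach P w (St (pc + 1) l (r.set d z) M X) t Q)
    (hP : P[pc]? = some (.realOp op d a b) := by rfl)
    (hd : Nat.blt d r.length = true := by rfl) :
    Reach P w (St pc l r M X) (t + 1) Q := by
  refine Reach.step ?_ h
  show (P[pc]?).bind _ = _
  rw [hP, ← St_writeReal hd]
  show (op.evalReal (r.getD a 0) (r.getD b 0)).map _ = _
  rw [hz]; rfl

theorem Reach.realDiv {y : ℝ} (z : ℝ) (hb : y ≠ 0)
    (h : Reach P w (St (pc + 1) l (r.set d z) M X) t Q)
    (hP : P[pc]? = some (.realOp .div d a b) := by rfl)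
    (hy : r.getD b 0 = y := by rfl)
    (hz : r.getD a 0 / r.getD b 0 = z := by rfl)
    (hd : Nat.blt d r.length = true := by rfl) :
    Reach P w (St pc l r M X) (t + 1) Q :=
  Reach.realOp z (by rw [Op.evalReal, if_neg (hy ▸ hb), hz]) h hP hd

theorem Reach.realLoad {m : ℕ} (x : ℝ) (hx : X m = x)
    (h : Reach P w (St (pc + 1) l (r.set d x) M X) t Q)
    (hP : P[pc]? = some (.realLoad d a) := by rfl)
    (hm : l.getD a 0 = m := by rfl)
    (hd : Nat.blt d r.length = true := by rfl) :
    Reach P w (St pc l r M X) (t + 1) Q := by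
  refine Reach.step ?_ h
  show (P[pc]?).bind _ = _
  rw [hP, ← St_writeReal hd, ← hx, ← hm]
  simp only [Option.bind_some, Instr.exec, St_address]; rfl

theorem Reach.realStore (m : ℕ) (x : ℝ)
    (h : Reach P w (St (pc + 1) l r M (Function.update X m x)) t Q)
    (hP : P[pc]? = some (.realStore a b) := by rfl)
    (hm : l.getD a 0 = m := by rfl) (hx : r.getD b 0 = x := by rfl) :
    Reach P w (St pc l r M X) (t + 1) Q := by
  refine Reach.step ?_ h
  show (P[pc]?).bind _ = _
  rw [hP]
  simp only [Option.bind_some, Instr.exec, St_address, hm, ← hx]; rfl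

theorem Reach.intJump_pos {e : ℕ} {x y : ℕ} (hab : x ≤ y)
    (h : Reach P w (St e l r M X) t Q)
    (hP : P[pc]? = some (.intJumpLE a b e) := by rfl)
    (hx : l.getD a 0 = x := by rfl) (hy : l.getD b 0 = y := by rfl) :
    Reach P w (St pc l r M X) (t + 1) Q := by
  subst hx hy
  refine Reach.step ?_ h
  show (P[pc]?).bind _ = _
  rw [hP]
  show some (if ((l.getD a 0 : ℕ) : ℤ) ≤ ((l.getD b 0 : ℕ) : ℤ) then _ else _) = _
  rw [if_pos (by exact_mod_cast hab)]; rfl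

theorem Reach.intJump_neg {e : ℕ} {x y : ℕ} (hab : x < y)
    (h : Reach P w (St (pc + 1) l r M X) t Q)
    (hP : P[pc]? = some (.intJumpLE a b e) := by rfl)
    (hx : l.getD b 0 = x := by rfl) (hy : l.getD a 0 = y := by rfl) :
    Reach P w (St pc l r M X) (t + 1) Q := by
  subst hx hy
  refine Reach.step ?_ h
  show (P[pc]?).bind _ = _
  rw [hP]
  show some (if ((l.getD a 0 : ℕ) : ℤ) ≤ ((l.getD b 0 : ℕ) : ℤ) then _ else _) = _
  rw [if_neg (by exact_mod_cast hab.not_ge)]; rfl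

theorem Reach.realJump_pos {e : ℕ} {x y : ℝ} (hab : x ≤ y)
    (h : Reach P w (St e l r M X) t Q)
    (hP : P[pc]? = some (.realJumpLE a b e) := by rfl)
    (hx : r.getD a 0 = x := by rfl) (hy : r.getD b 0 = y := by rfl) :
    Reach P w (St pc l r M X) (t + 1) Q := by
  subst hx hy
  refine Reach.step ?_ h
  show (P[pc]?).bind _ = _
  rw [hP]
  show some (if r.getD a 0 ≤ r.getD b 0 then _ else _) = _
  rw [if_pos hab]; rfl

theorem Reach.realJump_neg {e : ℕ} {x y : ℝ} (hab : x < y)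
    (h : Reach P w (St (pc + 1) l r M X) t Q)
    (hP : P[pc]? = some (.realJumpLE a b e) := by rfl)
    (hx : r.getD b 0 = x := by rfl) (hy : r.getD a 0 = y := by rfl) :
    Reach P w (St pc l r M X) (t + 1) Q := by
  subst hx hy
  refine Reach.step ?_ h
  show (P[pc]?).bind _ = _
  rw [hP]
  show some (if r.getD a 0 ≤ r.getD b 0 then _ else _) = _
  rw [if_neg hab.not_ge]; rfl

end Rules

/-- Euler's sieve on the integers prime to `k!`, for a slowly growing `k`.

Integer registers: `0` number of primes found, `1` one, `2` zero, `3` `k`, `4` `k!`, `9` end of the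
list of primes; real registers: `0` product, `1` `δ`, `2` `1 + δ`, `6` one. Integer memory: distance
to the next candidate in the cells `0, ..., k!`, followed by the list of the primes above `k`. Real
memory: one in the cells of the crossed out candidates. -/
def sieve : Program :=
  [ -- 0: initialization
    .const 1 (1 : ℕ),
    .const 3 (2 : ℕ),
    .const 4 (2 : ℕ),
    .realOp .add 1 0 5,
    .cast 0 1,
    .cast 6 1,
    .realOp .add 2 1 6,
    -- 7: search for `k`
    .intOp .add 5 3 1,
    .intOp .mul 6 4 5,
    .intOp .mul 7 6 6,
    .intOp .mul 7 7 6,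
    .cast 3 7,
    .realOp .mul 3 3 1,
    .realJumpLE 2 3 17,
    .intOp .add 3 5 2,
    .intOp .add 4 6 2,
    .intJumpLE 2 2 7,
    -- 17: table of gaps, from the cell `k!` downwards
    .intOp .add 7 4 2,
    .intStore 4 1,
    .intOp .add 10 1 2,
    -- 20: gap in front of register `7`
    .intOp .add 8 1 1,
    -- 21: search for a divisor
    .intJumpLE 5 8 36,
    .intOp .div 6 7 8,
    .intOp .mul 6 6 8,
    .intJumpLE 7 6 27,
    .intOp .add 8 8 1,
    .intJumpLE 2 2 21,
    -- 27: register `8` is the least divisor of register `7`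
    .intJumpLE 7 8 29,
    .intJumpLE 2 2 34,
    -- 29: register `7` is a prime
    .cast 3 7,
    .realOp .sub 4 3 6,
    .realOp .div 3 3 4,
    .realOp .mul 0 0 3,
    .intOp .add 0 0 1,
    -- 34: register `7` is not a candidate
    .intOp .add 10 10 1,
    .intJumpLE 2 2 37,
    -- 36: register `7` is a candidate
    .intOp .add 10 1 2,
    -- 37: store the gap
    .intOp .sub 7 7 1,
    .intStore 7 10,
    .intJumpLE 1 7 20,
    -- 40: start of the sieve
    .intOp .add 9 4 1,
    .intOp .add 7 1 2,
    -- 42: next candidate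
    .intOp .div 6 7 4,
    .intOp .mul 6 6 4,
    .intOp .sub 6 7 6,
    .intLoad 6 6,
    .intOp .add 7 7 6,
    .cast 3 7,
    .realOp .mul 4 3 1,
    .realJumpLE 2 4 70,
    .realLoad 4 7,
    .realJumpLE 6 4 58,
    -- 52: the candidate is a prime
    .intStore 9 7,
    .intOp .add 9 9 1,
    .realOp .sub 4 3 6,
    .realOp .div 3 3 4,
    .realOp .mul 0 0 3,
    .intOp .add 0 0 1,
    -- 58: cross out the multiples of the candidate
    .intOp .add 8 4 1,
    .intLoad 5 8,
    .intOp .mul 6 5 7,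
    .cast 3 6,
    .realOp .mul 3 3 1,
    .realJumpLE 2 3 42,
    .realStore 6 6,
    .intOp .div 6 7 5,
    .intOp .mul 6 6 5,
    .intJumpLE 7 6 42,
    .intOp .add 8 8 1,
    .intJumpLE 2 2 59,
    -- 70: output
    .const 1 (2 : ℕ),
    .intOp .sub 0 0 1,
    .halt ]

/-! ### Rough numbers and their gaps. -/

open Nat

/-- No integer in `[2, k]` divides `x`. -/
def Rough (k x : ℕ) : Prop := ∀ e, 2 ≤ e → e ≤ k → ¬ e ∣ x

/-- `y + g` is the first `k`-rough number after `y`. -/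
def IsGap (k y g : ℕ) : Prop := 1 ≤ g ∧ Rough k (y + g) ∧ ∀ e, 1 ≤ e → e < g → ¬ Rough k (y + e)

/-- The composite `k`-rough number `c ≤ n` has been crossed out when the sieve works on the
multiples of `i` by primes, and has done the primes below `b`. -/
def Crossed (k n i b c : ℕ) : Prop :=
  Rough k c ∧ ¬ c.Prime ∧ 1 < c ∧ c ≤ n ∧
    (c / c.minFac < i ∨ c / c.minFac = i ∧ c.minFac < b)

section RoughNumbers

variable {k n i b c g x y p q : ℕ}

theorem rough_one : Rough k 1 := fun e he _ h => by
  have := Nat.le_of_dvd one_pos h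
  omega

theorem Rough.lt (h : Rough k x) (hx : 1 < x) : k < x := by
  by_contra hk
  exact h x hx (by omega) dvd_rfl

theorem Rough.of_dvd (h : Rough k x) (hy : y ∣ x) : Rough k y :=
  fun e he hek hd => h e he hek (hd.trans hy)

theorem rough_prime (hp : p.Prime) (hk : k < p) : Rough k p := fun e he hek hd => by
  rcases (Nat.dvd_prime hp).1 hd with h | h <;> omega

theorem Rough.mul (hp : Rough k x) (hx : Rough k y) : Rough k (x * y) := fun e he hek hd => by
  have hr : e.minFac.Prime := Nat.minFac_prime (by omega)
  have hle : e.minFac ≤ k := (Nat.minFac_le (by omega)).trans hek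
  rcases hr.dvd_mul.1 ((Nat.minFac_dvd e).trans hd) with h | h
  · exact hp _ hr.two_le hle h
  · exact hx _ hr.two_le hle h

theorem Rough.lt_minFac (h : Rough k x) (hx : 1 < x) : k < x.minFac :=
  (h.of_dvd (Nat.minFac_dvd x)).lt (Nat.minFac_prime (by omega)).one_lt

/-- Every `d` in `[2, k]` divides `k!`, so roughness is periodic modulo `k!`. This is why a finite
table of gaps suffices. -/
theorem rough_mod_add_iff (i e : ℕ) : Rough k (i % k ! + e) ↔ Rough k (i + e) := by
  have h : ∀ d, 2 ≤ d → d ≤ k → (d ∣ i % k ! + e ↔ d ∣ i + e) := fun d hd hdk => by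
    have hdvd : d ∣ k ! * (i / k !) := (Nat.dvd_factorial (by omega) hdk).mul_right _
    conv_rhs => rw [← Nat.mod_add_div i (k !)]
    rw [add_right_comm, Nat.dvd_add_left hdvd]
  exact forall_congr' fun d => forall_congr' fun hd => forall_congr' fun hdk => not_congr (h d hd hdk)

theorem IsGap.of_mod (h : IsGap k (i % k !) g) : IsGap k i g :=
  ⟨h.1, (rough_mod_add_iff i g).1 h.2.1,
    fun e he heg hr => h.2.2 e he heg ((rough_mod_add_iff i e).2 hr)⟩

theorem isGap_one (h : Rough k (y + 1)) : IsGap k y 1 := ⟨le_rfl, h, fun e he heg => by omega⟩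

theorem IsGap.pred (h : ¬ Rough k (y + 1)) (hg : IsGap k (y + 1) g) : IsGap k y (g + 1) := by
  refine ⟨by omega, by have := hg.2.1; rwa [add_assoc, add_comm 1] at this, fun e he heg => ?_⟩
  rcases he.eq_or_lt with rfl | he
  · exact h
  · have := hg.2.2 (e - 1) (by omega) (by omega)
    rwa [add_assoc, Nat.add_sub_cancel' (by omega)] at this

theorem isGap_factorial : IsGap k (k !) 1 :=
  isGap_one (by
    have := rough_mod_add_iff (k := k) (k !) 1
    rw [Nat.mod_self, zero_add] at this
    exact this.1 rough_one)

/-- The next number congruent to 1 modulo `k!` after the current block is rough. The bound keeps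
table entries within the word size. -/
theorem IsGap.le (h : IsGap k y g) : g ≤ k ! + 1 := by
  have hpos := Nat.factorial_pos k
  have hm := Nat.mod_lt y hpos
  by_contra hg
  refine h.2.2 ((k !) - y % (k !) + 1) (by omega) (by omega) ?_
  rw [← rough_mod_add_iff]
  have : y % k ! + ((k !) - y % (k !) + 1) = k ! + 1 := by omega
  rw [this]
  exact isGap_factorial.2.1

theorem IsGap.le_of_rough (h : IsGap k y g) (hx : Rough k x) (hyx : y < x) : y + g ≤ x := by
  by_contra hlt
  refine h.2.2 (x - y) (by omega) (by omega) ?_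
  rwa [Nat.add_sub_cancel' hyx.le]

theorem IsGap.lt_add (h : IsGap k i g) (hi : 1 ≤ i) : max i k < i + g :=
  max_lt (by have := h.1; omega) (h.2.1.lt (by have := h.1; omega))

theorem count_eq_count_of_forall_not {P : ℕ → Prop} [DecidablePred P] {a b : ℕ} (hab : a ≤ b)
    (h : ∀ x, a ≤ x → x < b → ¬ P x) : Nat.count P b = Nat.count P a := by
  induction b, hab using Nat.le_induction with
  | base => rfl
  | succ b hab ih =>
    rw [Nat.count_succ, if_neg (h b hab (by omega)), ih fun x h1 h2 => h x h1 (by omega)]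
    rfl

/-! ### Counting primes, and the product over them, along the candidates. -/

/-- The number of primes up to `m`. -/
noncomputable def cnt (m : ℕ) : ℕ := Nat.count Nat.Prime (m + 1)

/-- The product of `p / (p - 1)` over the primes `p ≤ m`. -/
noncomputable def prd (m : ℕ) : ℝ :=
  ∏ t ∈ Finset.range (cnt m), (nthPrime t : ℝ) / ((nthPrime t : ℝ) - 1)

theorem cnt_mono {a b : ℕ} (h : a ≤ b) : cnt a ≤ cnt b := Nat.count_monotone _ (by omega)

theorem cnt_succ_of_not_prime (h : ¬ (x + 1).Prime) : cnt (x + 1) = cnt x := by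
  rw [cnt, Nat.count_succ, if_neg h]; rfl

theorem cnt_succ_of_prime (h : (x + 1).Prime) : cnt (x + 1) = cnt x + 1 := by
  rw [cnt, Nat.count_succ, if_pos h]; rfl

theorem nthPrime_cnt (h : (x + 1).Prime) : nthPrime (cnt x) = x + 1 := Nat.nth_count h

theorem prd_congr {a b : ℕ} (h : cnt a = cnt b) : prd a = prd b := by rw [prd, prd, h]

theorem prd_succ_of_prime (h : (x + 1).Prime) :
    prd (x + 1) = prd x * (((x + 1 : ℕ) : ℝ) / (((x + 1 : ℕ) : ℝ) - 1)) := by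
  rw [prd, cnt_succ_of_prime h, Finset.prod_range_succ, nthPrime_cnt h, prd]

theorem cnt_le (m : ℕ) : cnt m ≤ m := by
  induction m with
  | zero => simp [cnt, Nat.count_succ, Nat.not_prime_zero]
  | succ m ih =>
    by_cases h : (m + 1).Prime
    · rw [cnt_succ_of_prime h]; omega
    · rw [cnt_succ_of_not_prime h]; omega

theorem cnt_eq_of_forall {a b : ℕ} (hab : a ≤ b) (h : ∀ x, a < x → x ≤ b → ¬ x.Prime) :
    cnt b = cnt a :=
  count_eq_count_of_forall_not (by omega) fun x h1 h2 => h x (by omega) (by omega)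

/-- Primes above `k` are rough, so none lies strictly inside a gap. The maximum with `k` is needed
because the sieve starts at `i = 1` with the primes up to `k` already counted. -/
theorem IsGap.cnt_eq (h : IsGap k i g) (hm : max i k ≤ x) (hx : x < i + g) :
    cnt x = cnt (max i k) :=
  cnt_eq_of_forall hm fun y h1 h2 hy =>
    absurd (h.le_of_rough (rough_prime hy (lt_of_le_of_lt (le_max_right _ _) h1))
      (lt_of_le_of_lt (le_max_left _ _) h1)) (by omega)

theorem IsGap.cnt_of_not_prime (h : IsGap k i g) (hi : 1 ≤ i) (hp : ¬ (i + g).Prime) :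
    cnt (max (i + g) k) = cnt (max i k) := by
  have hlt := h.lt_add hi
  obtain ⟨x, hx⟩ : ∃ x, i + g = x + 1 := ⟨i + g - 1, by omega⟩
  rw [max_eq_left (by have := le_max_right i k; omega)]
  rw [hx] at hp ⊢
  rw [cnt_succ_of_not_prime hp, h.cnt_eq (by omega) (by omega)]

theorem IsGap.cnt_of_prime (h : IsGap k i g) (hi : 1 ≤ i) (hp : (i + g).Prime) :
    cnt (max (i + g) k) = cnt (max i k) + 1 ∧ nthPrime (cnt (max i k)) = i + g ∧
      prd (max (i + g) k) = prd (max i k) * (((i + g : ℕ) : ℝ) / (((i + g : ℕ) : ℝ) - 1)) := by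
  have hlt := h.lt_add hi
  obtain ⟨x, hx⟩ : ∃ x, i + g = x + 1 := ⟨i + g - 1, by omega⟩
  rw [max_eq_left (by have := le_max_right i k; omega)]
  have hc := h.cnt_eq (x := x) (by omega) (by omega)
  rw [hx] at hp ⊢
  rw [cnt_succ_of_prime hp, ← nthPrime_cnt hp, hc]
  exact ⟨rfl, rfl, by rw [← hc, nthPrime_cnt hp, prd_succ_of_prime hp,
    prd_congr (hc : cnt x = cnt (max i k))]⟩

theorem infinite_primes : (Set.ofPred Nat.Prime).Infinite := Nat.infinite_setOfPred_prime

theorem nthPrime_prime (t : ℕ) : (nthPrime t).Prime := Nat.prime_nth_prime t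

theorem lt_nthPrime_iff (m t : ℕ) : m < nthPrime t ↔ cnt m ≤ t :=
  (Nat.count_le_iff_le_nth infinite_primes).symm

theorem nthPrime_lt_iff {s t : ℕ} : nthPrime s < nthPrime t ↔ s < t :=
  Nat.nth_lt_nth infinite_primes

theorem prime_eq_nthPrime (hp : p.Prime) : ∃ t, p = nthPrime t :=
  ⟨_, (Nat.nth_count hp).symm⟩

theorem prime_lt_nthPrime_succ_iff (hp : p.Prime) (t : ℕ) :
    p < nthPrime (t + 1) ↔ p ≤ nthPrime t := by
  obtain ⟨s, rfl⟩ := prime_eq_nthPrime hp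
  rw [nthPrime_lt_iff, ← not_lt, nthPrime_lt_iff]
  omega

/-! ### Which composites are crossed out at each stage. -/

theorem minFac_mul_div (c : ℕ) : c.minFac * (c / c.minFac) = c :=
  Nat.mul_div_cancel' (Nat.minFac_dvd c)

theorem one_lt_div_minFac (hc : 1 < c) (hp : ¬ c.Prime) : 1 < c / c.minFac := by
  have h := minFac_mul_div c
  have hpr := Nat.minFac_prime (n := c) (by omega)
  rcases Nat.lt_trichotomy (c / c.minFac) 1 with h0 | h1 | h2
  · have : c / c.minFac = 0 := Nat.lt_one_iff.1 h0
    rw [this] at h; omega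
  · rw [h1, mul_one] at h
    exact absurd (h ▸ hpr) hp
  · exact h2

theorem minFac_le_minFac_div (hc : 1 < c) (hp : ¬ c.Prime) : c.minFac ≤ (c / c.minFac).minFac := by
  have h1 := one_lt_div_minFac hc hp
  exact Nat.minFac_le_of_dvd (Nat.minFac_prime (by omega)).two_le
    ((Nat.minFac_dvd _).trans (Nat.div_dvd_of_dvd (Nat.minFac_dvd c)))

theorem not_crossed_two_zero : ¬ Crossed k n 2 0 c := fun h => by
  have := one_lt_div_minFac h.2.2.1 h.2.1
  rcases h.2.2.2.2 with h | h <;> omega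

/-- The cofactor `c / c.minFac` is rough, hence not strictly between `i` and `i + g`; and no rough
number has a least prime factor below `b`. So moving to the next candidate changes nothing. -/
theorem IsGap.crossed_iff (h : IsGap k i g) (hb : ∀ p, p.Prime → k < p → b ≤ p) (c : ℕ) :
    Crossed k n (i + 1) 0 c ↔ Crossed k n (i + g) b c := by
  refine and_congr_right fun hr => and_congr_right fun hp => and_congr_right fun h1 =>
    and_congr_right fun _ => ?_
  have hlt := hr.lt_minFac h1
  have := hb _ (Nat.minFac_prime (by omega)) hlt
  have hd := hr.of_dvd (Nat.div_dvd_of_dvd (Nat.minFac_dvd c))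
  have hg := h.1
  constructor
  · rintro (h' | h') <;> left <;> omega
  · rintro (h' | h')
    · left
      by_contra hlt'
      have := h.le_of_rough hd (by omega)
      omega
    · omega

/-- The exit criterion of the inner loop: no composite with cofactor `i` is left to be crossed out.
-/
theorem crossed_succ_iff (h : ∀ c, 1 < c → ¬ c.Prime → c ≤ n → c / c.minFac = i → c.minFac < b)
    (c : ℕ) : Crossed k n i b c ↔ Crossed k n (i + 1) 0 c := by
  refine and_congr_right fun hr => and_congr_right fun hp => and_congr_right fun h1 =>
    and_congr_right fun hn => ?_
  have := h c h1 hp hn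
  constructor
  · rintro (h' | h') <;> left <;> omega
  · rintro (h' | h')
    · rcases (show c / c.minFac ≤ i by omega).lt_or_eq with h | h
      · exact Or.inl h
      · exact Or.inr ⟨h, this h⟩
    · omega

theorem minFac_mul_of_le (hq : q.Prime) (hi : 1 < i) (h : q ≤ i.minFac) : (q * i).minFac = q := by
  refine le_antisymm (Nat.minFac_le_of_dvd hq.two_le (dvd_mul_right _ _)) ?_
  have hq1 := hq.one_lt
  have hp : (q * i).minFac.Prime := Nat.minFac_prime (by nlinarith)
  rcases hp.dvd_mul.1 (Nat.minFac_dvd (q * i)) with h1 | h1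
  · exact ((Nat.prime_dvd_prime_iff_eq hp hq).1 h1).ge
  · exact h.trans (Nat.minFac_le_of_dvd hp.two_le h1)

theorem crossed_mul_iff (hq : q.Prime) (hqk : k < q) (hr : Rough k i) (hi : 1 < i)
    (h : q ≤ i.minFac) (hn : q * i ≤ n) (b : ℕ) : Crossed k n i b (q * i) ↔ q < b := by
  have hm := minFac_mul_of_le hq hi h
  have hq1 := hq.one_lt
  have hdiv : q * i / q = i := Nat.mul_div_cancel_left i hq.pos
  simp only [Crossed, hm, hdiv, lt_irrefl, false_or, true_and]
  constructor
  · exact fun h => h.2.2.2.2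
  · exact fun hb => ⟨(rough_prime hq hqk).mul hr, Nat.not_prime_mul (by omega) (by omega),
      by nlinarith, hn, hb⟩

theorem crossed_next_iff (hq : q.Prime) (hqk : k < q) (hr : Rough k i) (hi : 1 < i)
    (h : q ≤ i.minFac) (hn : q * i ≤ n) (hb : ∀ p, p.Prime → (p < b ↔ p ≤ q)) (c : ℕ) :
    Crossed k n i b c ↔ Crossed k n i q c ∨ c = q * i := by
  constructor
  · rintro ⟨h1, h2, h3, h4, h5 | ⟨h5, h6⟩⟩
    · exact Or.inl ⟨h1, h2, h3, h4, Or.inl h5⟩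
    · rcases ((hb _ (Nat.minFac_prime (by omega))).1 h6).lt_or_eq with h7 | h7
      · exact Or.inl ⟨h1, h2, h3, h4, Or.inr ⟨h5, h7⟩⟩
      · right
        rw [← h7, ← h5, minFac_mul_div]
  · rintro (⟨h1, h2, h3, h4, h5 | ⟨h5, h6⟩⟩ | rfl)
    · exact ⟨h1, h2, h3, h4, Or.inl h5⟩
    · exact ⟨h1, h2, h3, h4, Or.inr ⟨h5, (hb _ (Nat.minFac_prime (by omega))).2 h6.le⟩⟩
    · exact (crossed_mul_iff hq hqk hr hi h hn b).2 ((hb q hq).2 le_rfl)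

/-- The cofactor of a composite candidate is smaller than the candidate, so the candidate was
crossed out while an earlier one was treated. Hence an unmarked candidate is a prime. -/
theorem IsGap.crossed_candidate_iff (h : IsGap k i g) (hi : 1 ≤ i) (hn : i + g ≤ n) :
    Crossed k n (i + 1) 0 (i + g) ↔ ¬ (i + g).Prime := by
  have hg := h.1
  refine ⟨fun h => h.2.1, fun hp => ?_⟩
  rw [h.crossed_iff (b := 0) fun _ _ _ => Nat.zero_le _]
  refine ⟨h.2.1, hp, by omega, hn, Or.inl ?_⟩
  exact Nat.div_lt_self (by omega) (Nat.minFac_prime (by omega)).one_lt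

/-! ### The finite sets that measure the running time. -/

open Classical in
/-- The numbers crossed out so far. -/
noncomputable def crossedSet (k n i b : ℕ) : Finset ℕ :=
  (Finset.range (n + 1)).filter (Crossed k n i b)

open Classical in
/-- The `k`-rough numbers in `(i, n]`. -/
noncomputable def roughSet (k n i : ℕ) : Finset ℕ :=
  (Finset.Ioc i n).filter (Rough k)

theorem mem_crossedSet : c ∈ crossedSet k n i b ↔ Crossed k n i b c := by
  simp only [crossedSet, Finset.mem_filter, Finset.mem_range, and_iff_right_iff_imp]
  exact fun h => Nat.lt_succ_of_le h.2.2.2.1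

theorem crossedSet_congr {i' b' : ℕ} (h : ∀ c, Crossed k n i b c ↔ Crossed k n i' b' c) :
    crossedSet k n i b = crossedSet k n i' b' := by
  ext c; rw [mem_crossedSet, mem_crossedSet, h]

theorem crossedSet_subset : crossedSet k n i b ⊆ roughSet k n 0 := fun c hc => by
  rw [mem_crossedSet] at hc
  simp only [roughSet, Finset.mem_filter, Finset.mem_Ioc]
  exact ⟨⟨by have := hc.2.2.1; omega, hc.2.2.2.1⟩, hc.1⟩

theorem roughSet_subset : roughSet k n i ⊆ roughSet k n 0 := fun c hc => by
  simp only [roughSet, Finset.mem_filter, Finset.mem_Ioc] at hc ⊢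
  exact ⟨⟨by omega, hc.1.2⟩, hc.2⟩

/-- Every crossing marks a new number. This is the linearity of Euler's sieve. -/
theorem crossedSet_next (hq : q.Prime) (hqk : k < q) (hr : Rough k i) (hi : 1 < i)
    (h : q ≤ i.minFac) (hn : q * i ≤ n) (hb : ∀ p, p.Prime → (p < b ↔ p ≤ q)) :
    (crossedSet k n i b).card = (crossedSet k n i q).card + 1 := by
  rw [← Finset.card_insert_of_notMem (a := q * i)]
  · congr 1
    ext c
    rw [Finset.mem_insert, mem_crossedSet, mem_crossedSet, crossed_next_iff hq hqk hr hi h hn hb,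
      or_comm]
  · rw [mem_crossedSet, crossed_mul_iff hq hqk hr hi h hn]
    exact lt_irrefl q

theorem crossedSet_subset_succ : crossedSet k n i b ⊆ crossedSet k n (i + 1) 0 := by
  intro c
  rw [mem_crossedSet, mem_crossedSet]
  rintro ⟨h1, h2, h3, h4, h5⟩
  exact ⟨h1, h2, h3, h4, Or.inl (by omega)⟩

theorem IsGap.roughSet_card (h : IsGap k i g) (hn : i + g ≤ n) :
    (roughSet k n (i + g)).card + 1 ≤ (roughSet k n i).card := by
  rw [← Finset.card_insert_of_notMem (a := i + g) (by simp [roughSet])]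
  refine Finset.card_le_card fun c hc => ?_
  have hg := h.1
  rw [Finset.mem_insert] at hc
  simp only [roughSet, Finset.mem_filter, Finset.mem_Ioc] at hc ⊢
  rcases hc with rfl | hc
  · exact ⟨⟨by omega, hn⟩, h.2.1⟩
  · exact ⟨⟨by omega, hc.1.2⟩, hc.2⟩

end RoughNumbers

/-! ### Running the program: initialization and choice of `k`. -/

section Runs

variable {w n : ℕ} {δ : ℝ}

theorem Reach.start {Q : State → Prop} {t : ℕ} (hB : 1000 * (n + 1) ^ 2 < 2 ^ w)
    (h : Reach sieve w (St 7 [0, 1, 0, 2, 2, 0, 0, 0, 0, 0, 0]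
      [((1 : ℕ) : ℝ), δ, 1 + δ, 0, 0, 0, ((1 : ℕ) : ℝ)] (fun _ => 0) (fun _ => 0)) t Q) :
    Reach sieve w (init δ) (t + 7) Q := by
  have hn : 1 ≤ (n + 1) ^ 2 := Nat.one_le_pow _ _ (by omega)
  have : init δ = St 0 [0, 0, 0, 0, 0, 0, 0, 0, 0, 0, 0] [δ, 0, 0, 0, 0, 0, 0]
      (fun _ => 0) (fun _ => 0) := by
    simp only [init, St, State.mk.injEq, true_and]
    refine ⟨?_, ?_, ?_⟩
    · funext i
      rcases i with _ | _ | _ | _ | _ | _ | _ | _ | _ | _ | _ | i <;> simp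
    · funext i
      rcases i with _ | _ | _ | _ | _ | _ | _ | i <;> simp
    · simp
  rw [this]
  refine Reach.const 1 (by omega) ?_
  refine Reach.const 2 (by omega) ?_
  refine Reach.const 2 (by omega) ?_
  refine Reach.realOp (op := .add) (a := 0) (b := 5) δ (by simp [Op.evalReal]) ?_
  refine Reach.cast 1 ?_
  refine Reach.cast 1 ?_
  refine Reach.realOp (op := .add) (a := 1) (b := 6) (1 + δ) (by simp [Op.evalReal, add_comm]) ?_
  exact h

theorem succ_le_factorial {k : ℕ} (hk : 3 ≤ k) : k + 1 ≤ k ! := by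
  induction k, hk using Nat.le_induction with
  | base => decide
  | succ k hk ih => rw [Nat.factorial_succ]; nlinarith

/-- The search tests `(k + 1)!^3`, which may exceed `n`; it stays quadratic in `n` because `k + 1 ≤
k!` for `k ≥ 3`. The constant is `3!^3`, from `k = 2`. -/
theorem cube_le {k : ℕ} (hk : 2 ≤ k) (hkn : k = 2 ∨ k ! ^ 3 ≤ n) :
    (k ! * (k + 1)) ^ 3 ≤ 216 * (n + 1) ^ 2 := by
  have hn : 1 ≤ (n + 1) ^ 2 := Nat.one_le_pow _ _ (by omega)
  by_cases h : k = 2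
  · subst h; change (2 * (2 + 1)) ^ 3 ≤ _; omega
  · have h1 := hkn.resolve_left h
    have h2 : (k + 1) ^ 3 ≤ n := (Nat.pow_le_pow_left (succ_le_factorial (by omega)) 3).trans h1
    rw [mul_pow]
    calc k ! ^ 3 * (k + 1) ^ 3 ≤ n * n := Nat.mul_le_mul h1 h2
      _ ≤ 216 * (n + 1) ^ 2 := by nlinarith

theorem Reach.search (hB : 1000 * (n + 1) ^ 2 < 2 ^ w)
    (ht : ∀ c : ℕ, 1 + δ ≤ (c : ℝ) * δ ↔ n < c) {A r3 r4 : ℝ} {M : ℕ → ℕ} {X : ℕ → ℝ}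
    {k x5 x6 x7 : ℕ} (hk : 2 ≤ k) (hkn : k = 2 ∨ k ! ^ 3 ≤ n) :
    ∃ k', k ≤ k' ∧ (k' = 2 ∨ k' ! ^ 3 ≤ n) ∧ n < (k' + 1) ! ^ 3 ∧
      Reach sieve w (St 7 [0, 1, 0, k, k !, x5, x6, x7, 0, 0, 0]
        [A, δ, 1 + δ, r3, r4, 0, ((1 : ℕ) : ℝ)] M X) (10 * (k' - k) + 7)
        (fun s => ∃ y6 y7 s3, s = St 17 [0, 1, 0, k', k' !, k' + 1, y6, y7, 0, 0, 0]
          [A, δ, 1 + δ, s3, r4, 0, ((1 : ℕ) : ℝ)] M X) := by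
  have hc := cube_le hk hkn
  have hpos : 1 ≤ k ! * (k + 1) := Nat.mul_pos (Nat.factorial_pos k) (by omega)
  have hself := Nat.le_self_pow (n := 3) (by decide) (k ! * (k + 1))
  have hsq : k ! * (k + 1) * (k ! * (k + 1)) ≤ (k ! * (k + 1)) ^ 3 := by
    rw [pow_succ, pow_two]; exact Nat.le_mul_of_pos_right _ hpos
  have hk1 : k + 1 ≤ k ! * (k + 1) := Nat.le_mul_of_pos_left _ (Nat.factorial_pos k)
  have hcube : k ! * (k + 1) * (k ! * (k + 1)) * (k ! * (k + 1)) = (k ! * (k + 1)) ^ 3 := by ring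
  have hfac : (k + 1) ! = k ! * (k + 1) := by rw [Nat.factorial_succ, mul_comm]
  have hrun : ∀ {t Q},
      Reach sieve w (St 13 [0, 1, 0, k, k !, k + 1, k ! * (k + 1),
        k ! * (k + 1) * (k ! * (k + 1)) * (k ! * (k + 1)), 0, 0, 0]
        [A, δ, 1 + δ, ((k ! * (k + 1) * (k ! * (k + 1)) * (k ! * (k + 1)) : ℕ) : ℝ) * δ, r4, 0,
          ((1 : ℕ) : ℝ)] M X) t Q →
      Reach sieve w (St 7 [0, 1, 0, k, k !, x5, x6, x7, 0, 0, 0]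
        [A, δ, 1 + δ, r3, r4, 0, ((1 : ℕ) : ℝ)] M X) (t + 6) Q := by
    intro t Q h
    refine Reach.add (k + 1) (by omega) ?_
    refine Reach.mul (k ! * (k + 1)) (by omega) ?_
    refine Reach.mul (k ! * (k + 1) * (k ! * (k + 1))) (by omega) ?_
    refine Reach.mul (k ! * (k + 1) * (k ! * (k + 1)) * (k ! * (k + 1))) (by omega) ?_
    refine Reach.cast (k ! * (k + 1) * (k ! * (k + 1)) * (k ! * (k + 1))) ?_
    refine Reach.realOp (((k ! * (k + 1) * (k ! * (k + 1)) * (k ! * (k + 1)) : ℕ) : ℝ) * δ) rfl ?_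
    exact h
  have htest := ht (k ! * (k + 1) * (k ! * (k + 1)) * (k ! * (k + 1)))
  by_cases hn : n < (k + 1) ! ^ 3
  · refine ⟨k, le_rfl, hkn, hn, ?_⟩
    rw [Nat.sub_self]
    refine hrun (Reach.realJump_pos ?_ (Reach.done ⟨_, _, _, rfl⟩))
    exact htest.2 (by rw [hcube, ← hfac]; exact hn)
  · have hn' := not_lt.1 hn
    have hkn' : k < n := by
      have := Nat.le_self_pow (n := 3) (by decide) ((k + 1) !)
      have := Nat.self_le_factorial (k + 1)
      omega
    obtain ⟨k', h1, h2, h3, h4⟩ := Reach.search (A := A) (r4 := r4) (M := M) (X := X)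
      (r3 := ((k ! * (k + 1) * (k ! * (k + 1)) * (k ! * (k + 1)) : ℕ) : ℝ) * δ)
      (k := k + 1) (x5 := k + 1) (x6 := k ! * (k + 1))
      (x7 := k ! * (k + 1) * (k ! * (k + 1)) * (k ! * (k + 1))) hB ht (by omega) (Or.inr hn')
    refine ⟨k', by omega, h2, h3, ?_⟩
    have htime : 10 * (k' - k) + 7 = 10 * (k' - (k + 1)) + 7 + 4 + 6 := by omega
    rw [htime]
    refine hrun ?_
    refine Reach.realJump_neg ?_ ?_
    · exact lt_of_not_ge fun h => by
        have := htest.1 h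
        rw [hcube, ← hfac] at this
        omega
    refine Reach.add (k + 1) (by omega) ?_
    refine Reach.add (k ! * (k + 1)) (by omega) ?_
    refine Reach.intJump_pos (le_refl 0) ?_
    rw [hfac] at h4
    exact h4
termination_by n - k

/-! ### Building the table of gaps. -/

theorem le_div_mul_self_iff {x d : ℕ} : x ≤ x / d * d ↔ d ∣ x := by
  rw [Nat.dvd_iff_div_mul_eq]
  exact ⟨fun h => le_antisymm (Nat.div_mul_le_self x d) h, fun h => h.ge⟩

theorem Reach.divisor {r : List ℝ} {M : ℕ → ℕ} {X : ℕ → ℝ} {k c x6 x x9 g : ℕ} (d : ℕ)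
    (hW : k + 1 < 2 ^ w) (hx : x < 2 ^ w) (hd2 : 2 ≤ d) (hdk : d ≤ k + 1)
    (hd : ∀ e, 2 ≤ e → e < d → ¬ e ∣ x) :
    Reach sieve w (St 21 [c, 1, 0, k, k !, k + 1, x6, x, d, x9, g] r M X) (6 * (k + 1 - d) + 4)
      (fun s => ∃ y6 d',
        (s = St 36 [c, 1, 0, k, k !, k + 1, y6, x, d', x9, g] r M X ∧ Rough k x) ∨
        (s = St 27 [c, 1, 0, k, k !, k + 1, y6, x, d', x9, g] r M X ∧ 2 ≤ d' ∧ d' ≤ k ∧ d' ∣ x ∧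
          ∀ e, 2 ≤ e → e < d' → ¬ e ∣ x)) := by
  by_cases hdk' : d = k + 1
  · subst hdk'
    refine Reach.intJump_pos (le_refl (k + 1)) (Reach.done ⟨x6, k + 1, Or.inl ⟨rfl, ?_⟩⟩)
    exact fun e he hek => hd e he (by omega)
  have h1 : x / d ≤ x := Nat.div_le_self x d
  have h2 : x / d * d ≤ x := Nat.div_mul_le_self x d
  refine Reach.intJump_neg (show d < k + 1 by omega) ?_
  refine Reach.div (x / d) (show d ≠ 0 by omega) (by omega) ?_
  refine Reach.mul (x / d * d) (by omega) ?_
  by_cases hdx : d ∣ x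
  · refine Reach.intJump_pos (le_div_mul_self_iff.2 hdx) ?_
    exact Reach.done ⟨x / d * d, d, Or.inr ⟨rfl, hd2, by omega, hdx, hd⟩⟩
  · have htime : 6 * (k + 1 - d) = 6 * (k + 1 - (d + 1)) + 4 + 2 := by omega
    rw [htime]
    refine Reach.intJump_neg (not_le.1 (mt le_div_mul_self_iff.1 hdx)) ?_
    refine Reach.add (d + 1) (by omega) ?_
    refine Reach.intJump_pos (le_refl 0) ?_
    refine Reach.divisor (d + 1) hW hx (by omega) (by omega) ?_
    intro e he hed
    rcases (show e ≤ d by omega).lt_or_eq with h | rfl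
    · exact hd e he h
    · exact hdx
termination_by k + 1 - d

theorem prime_of_forall_not_dvd {x : ℕ} (hx : 2 ≤ x) (h : ∀ e, 2 ≤ e → e < x → ¬ e ∣ x) :
    x.Prime :=
  Nat.prime_def.2 ⟨hx, fun e he => by
    have he0 := Nat.pos_of_dvd_of_pos he (by omega)
    have hle := Nat.le_of_dvd (by omega) he
    by_contra hne
    rw [not_or] at hne
    exact h e (by omega) (by omega) he⟩

theorem cnt_min_succ {k x : ℕ} (h : ¬ ((x + 1).Prime ∧ x + 1 ≤ k)) :
    cnt (min (x + 1) k) = cnt (min x k) := by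
  by_cases hk : x + 1 ≤ k
  · rw [min_eq_left hk, min_eq_left (by omega)]
    exact cnt_succ_of_not_prime fun hp => h ⟨hp, hk⟩
  · rw [min_eq_right (by omega), min_eq_right (by omega)]

/-- One entry of the table of gaps. -/
theorem Reach.gap {A r3 r4 : ℝ} {M : ℕ → ℕ} {X : ℕ → ℝ} {k c x6 x x8 x9 g : ℕ}
    (hk : 2 ≤ k) (hW : k ! + 2 < 2 ^ w) (hx : x + 1 ≤ k !) (hg : IsGap k (x + 1) g)
    (hc : c + cnt (min (x + 1) k) = cnt k) (hA : A * prd (min (x + 1) k) = prd k) :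
    Reach sieve w (St 20 [c, 1, 0, k, k !, k + 1, x6, x + 1, x8, x9, g]
      [A, δ, 1 + δ, r3, r4, 0, ((1 : ℕ) : ℝ)] M X) (6 * k + 11)
      (fun s => ∃ c' A' y6 y8 g' s3 s4, IsGap k x g' ∧ c' + cnt (min x k) = cnt k ∧
        A' * prd (min x k) = prd k ∧
        s = St 39 [c', 1, 0, k, k !, k + 1, y6, x, y8, x9, g']
          [A', δ, 1 + δ, s3, s4, 0, ((1 : ℕ) : ℝ)] (Function.update M x g') X) := by
  have hkW := Nat.self_le_factorial k
  have hgW := hg.le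
  have hcnt := cnt_le k
  have htime : 6 * k + 11 = ((6 * (k + 1 - 2) + 4) + 12) + 1 := by omega
  rw [htime]
  refine Reach.add 2 (by omega) ?_
  refine Reach.trans (u := 12) (Reach.divisor (w := w) (k := k) (x := x + 1) 2 (by omega)
    (by omega) le_rfl (by omega) (by omega)) ?_
  rintro s ⟨y6, d, ⟨rfl, hr⟩ | ⟨rfl, hd2, hdk, hdx, hd⟩⟩
  -- A rough `x + 1` ends the gap after `x`; otherwise, below, the gap after `x` is one more than
  -- the gap after `x + 1`.
  · have hnp : ¬ ((x + 1).Prime ∧ x + 1 ≤ k) := fun h => hr _ h.1.two_le h.2 dvd_rfl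
    rw [cnt_min_succ hnp] at hc
    rw [prd_congr (cnt_min_succ hnp)] at hA
    refine Reach.add 1 (by omega) ?_
    refine Reach.sub x (Eq.refl (x + 1)) (by omega) ?_
    refine Reach.intStore x 1 ?_
    exact Reach.done ⟨c, A, y6, d, 1, r3, r4, isGap_one hr, hc, hA, rfl⟩
  have hnr : ¬ Rough k (x + 1) := fun h => h d hd2 hdk hdx
  have hstore : ∀ {c' s3 s4 A'}, c' + cnt (min x k) = cnt k → A' * prd (min x k) = prd k →
      Reach sieve w (St 34 [c', 1, 0, k, k !, k + 1, y6, x + 1, d, x9, g]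
        [A', δ, 1 + δ, s3, s4, 0, ((1 : ℕ) : ℝ)] M X) 4
        (fun s => ∃ c' A' y6 y8 g' s3 s4, IsGap k x g' ∧ c' + cnt (min x k) = cnt k ∧
        A' * prd (min x k) = prd k ∧
        s = St 39 [c', 1, 0, k, k !, k + 1, y6, x, y8, x9, g']
          [A', δ, 1 + δ, s3, s4, 0, ((1 : ℕ) : ℝ)] (Function.update M x g') X) := by
    intro c' s3 s4 A' hc' hA'
    refine Reach.add (g + 1) (by omega) ?_
    refine Reach.intJump_pos (le_refl 0) ?_
    refine Reach.sub x (Eq.refl (x + 1)) (by omega) ?_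
    refine Reach.intStore x (g + 1) ?_
    exact Reach.done ⟨c', A', y6, d, g + 1, s3, s4, hg.pred hnr, hc', hA', rfl⟩
  by_cases hxd : x + 1 ≤ d
  · have hxd' : x + 1 = d := le_antisymm hxd (Nat.le_of_dvd (by omega) hdx)
    have hp : (x + 1).Prime := prime_of_forall_not_dvd (by omega) fun e he hed => hd e he (hxd' ▸ hed)
    have hx1 : (x : ℝ) ≠ 0 := by
      have := hp.two_le
      exact_mod_cast (by omega : x ≠ 0)
    rw [min_eq_left (by omega), cnt_succ_of_prime hp] at hc
    rw [min_eq_left (by omega), prd_succ_of_prime hp] at hA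
    refine Reach.intJump_pos hxd ?_
    refine Reach.cast (x + 1) ?_
    refine Reach.realOp (((x + 1 : ℕ) : ℝ) - ((1 : ℕ) : ℝ)) rfl ?_
    refine Reach.realDiv (((x + 1 : ℕ) : ℝ) / (((x + 1 : ℕ) : ℝ) - ((1 : ℕ) : ℝ)))
      (show ((x + 1 : ℕ) : ℝ) - ((1 : ℕ) : ℝ) ≠ 0 by simpa using hx1) ?_
    refine Reach.realOp
      (A * (((x + 1 : ℕ) : ℝ) / (((x + 1 : ℕ) : ℝ) - ((1 : ℕ) : ℝ)))) rfl ?_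
    refine Reach.add (c + 1) (by omega) ?_
    refine (hstore ?_ ?_).mono_time (by omega)
    · rw [min_eq_left (by omega)]; omega
    · rw [min_eq_left (by omega), ← hA, Nat.cast_one]; ring
  · have hnp : ¬ ((x + 1).Prime ∧ x + 1 ≤ k) := fun h => by
      rcases (Nat.dvd_prime h.1).1 hdx with h' | h' <;> omega
    rw [cnt_min_succ hnp] at hc
    rw [prd_congr (cnt_min_succ hnp)] at hA
    refine Reach.intJump_neg (not_le.1 hxd) ?_
    refine Reach.intJump_pos (le_refl 0) ?_
    exact (hstore hc hA).mono_time (by omega)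

/-- The table is filled downwards, since a gap is obtained from its successor. The primes up to `k`
are met on the way: `hc` and `hA` say that `c` and `A` account for those above `x + 1`. -/
theorem Reach.gaps_aux {A r3 r4 : ℝ} {M : ℕ → ℕ} {X : ℕ → ℝ} {k c x6 x8 x9 g : ℕ} (x : ℕ)
    (hk : 2 ≤ k) (hW : k ! + 2 < 2 ^ w) (hx : x + 1 ≤ k !) (hg : IsGap k (x + 1) g)
    (hc : c + cnt (min (x + 1) k) = cnt k) (hA : A * prd (min (x + 1) k) = prd k)
    (hM : ∀ y, x < y → y ≤ k ! → IsGap k y (M y)) :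
    Reach sieve w (St 20 [c, 1, 0, k, k !, k + 1, x6, x + 1, x8, x9, g]
      [A, δ, 1 + δ, r3, r4, 0, ((1 : ℕ) : ℝ)] M X) ((x + 1) * (6 * k + 12))
      (fun s => ∃ M' y6 y8 y10 s3 s4, (∀ y, y ≤ k ! → IsGap k y (M' y)) ∧
        s = St 40 [cnt k, 1, 0, k, k !, k + 1, y6, 0, y8, x9, y10]
          [prd k, δ, 1 + δ, s3, s4, 0, ((1 : ℕ) : ℝ)] M' X) := by
  induction x generalizing A r3 r4 M c x6 x8 g with
  | zero =>
    have htime : (0 + 1) * (6 * k + 12) = 6 * k + 11 + 1 := by ring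
    rw [htime]
    refine Reach.trans (u := 1) (Reach.gap hk hW hx hg hc hA) ?_
    rintro s ⟨c', A', y6, y8, g', s3, s4, hg', hc', hA', rfl⟩
    refine Reach.intJump_neg zero_lt_one (Reach.done ?_)
    have hc0 : cnt (min 0 k) = 0 := by
      rw [Nat.zero_min]; exact Nat.le_zero.1 (cnt_le 0)
    rw [prd, hc0, Finset.range_zero, Finset.prod_empty, mul_one] at hA'
    rw [hc0, add_zero] at hc'
    refine ⟨_, y6, y8, g', s3, s4, ?_, by rw [hc', hA']⟩
    intro y hy
    rcases Nat.eq_zero_or_pos y with rfl | h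
    · rwa [Function.update_self]
    · rw [Function.update_of_ne (by omega)]
      exact hM y h hy
  | succ x ih =>
    have htime : (x + 1 + 1) * (6 * k + 12) = (6 * k + 11) + ((x + 1) * (6 * k + 12) + 1) := by ring
    rw [htime]
    refine Reach.trans (u := (x + 1) * (6 * k + 12) + 1) (Reach.gap hk hW hx hg hc hA) ?_
    rintro s ⟨c', A', y6, y8, g', s3, s4, hg', hc', hA', rfl⟩
    refine Reach.intJump_pos (show 1 ≤ x + 1 by omega) ?_
    refine ih (by omega) hg' hc' hA' ?_
    intro y hy hyk
    rcases (show x + 1 ≤ y by omega).eq_or_lt with rfl | h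
    · rwa [Function.update_self]
    · rw [Function.update_of_ne (by omega)]
      exact hM y h hyk

theorem Reach.gaps {r3 r4 : ℝ} {M : ℕ → ℕ} {X : ℕ → ℝ} {k x6 x7 x8 x9 x10 : ℕ}
    (hk : 2 ≤ k) (hW : k ! + 2 < 2 ^ w) :
    Reach sieve w (St 17 [0, 1, 0, k, k !, k + 1, x6, x7, x8, x9, x10]
      [((1 : ℕ) : ℝ), δ, 1 + δ, r3, r4, 0, ((1 : ℕ) : ℝ)] M X) (k ! * (6 * k + 12) + 3)
      (fun s => ∃ M' y6 y8 y10 s3 s4, (∀ y, y ≤ k ! → IsGap k y (M' y)) ∧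
        s = St 40 [cnt k, 1, 0, k, k !, k + 1, y6, 0, y8, x9, y10]
          [prd k, δ, 1 + δ, s3, s4, 0, ((1 : ℕ) : ℝ)] M' X) := by
  have hkW := Nat.self_le_factorial k
  obtain ⟨x, hx⟩ : ∃ x, k ! = x + 1 := ⟨(k !) - 1, by omega⟩
  refine Reach.add (k !) (by omega) ?_
  refine Reach.intStore (k !) 1 ?_
  refine Reach.add 1 (by omega) ?_
  have h := Reach.gaps_aux (δ := δ) (A := ((1 : ℕ) : ℝ)) (r3 := r3) (r4 := r4)
    (M := Function.update M (k !) 1) (X := X) (c := 0) (x6 := x6) (x8 := x8) (x9 := x9) (g := 1)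
    x hk hW hx.ge (hx ▸ isGap_factorial) (by rw [min_eq_right (by omega), zero_add])
    (by rw [min_eq_right (by omega), Nat.cast_one, one_mul])
    (fun y hy hyk => by
      obtain rfl : y = k ! := by omega
      rw [Function.update_self]
      exact isGap_factorial)
  rw [← hx] at h
  exact h

/-! ### The sieve proper. -/

/-- The real memory `X` holds one in the cells `c` with `S c` and zero in the others. -/
def Marks (X : ℕ → ℝ) (S : ℕ → Prop) : Prop := ∀ c, S c ∧ X c = 1 ∨ ¬ S c ∧ X c = 0

theorem Marks.congr {X : ℕ → ℝ} {S S' : ℕ → Prop} (h : Marks X S) (hS : ∀ c, S c ↔ S' c) :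
    Marks X S' := fun c => by rw [← hS c]; exact h c

theorem Marks.update {X : ℕ → ℝ} {S S' : ℕ → Prop} {m : ℕ} (h : Marks X S)
    (hS : ∀ c, S' c ↔ S c ∨ c = m) : Marks (Function.update X m ((1 : ℕ) : ℝ)) S' := fun c => by
  by_cases hc : c = m
  · subst hc
    exact Or.inl ⟨(hS c).2 (Or.inr rfl), by simp⟩
  · rw [Function.update_of_ne hc, hS c, or_iff_left hc]
    exact h c

theorem nthPrime_cnt_le {k p : ℕ} (hp : p.Prime) (hk : k < p) : nthPrime (cnt k) ≤ p := by
  obtain ⟨s, rfl⟩ := prime_eq_nthPrime hp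
  rw [← not_lt, nthPrime_lt_iff, not_lt]
  exact (lt_nthPrime_iff _ _).1 hk

/-- The number `u` of crossings still due for `i` is the induction variable and pays for the loop.
The loop keeps `q ≤ i.minFac`, so that `q` is the least prime factor of `q * i`; `hM` ensures that
the list already holds every prime needed. -/
theorem Reach.crossOut (hB : 1000 * (n + 1) ^ 2 < 2 ^ w)
    (ht : ∀ c : ℕ, 1 + δ ≤ (c : ℝ) * δ ↔ n < c) {A r3 r4 : ℝ} {M : ℕ → ℕ} {X : ℕ → ℝ}
    {k c x5 x6 i x9 x10 t u : ℕ} (hW : k ! ≤ n + 2) (hi : 1 < i) (hin : i ≤ n) (hr : Rough k i)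
    (hM : ∀ s, nthPrime (cnt k + s) ≤ i → M (k ! + 1 + s) = nthPrime (cnt k + s))
    (hq : nthPrime (cnt k + t) ≤ i.minFac)
    (hX : Marks X (Crossed k n i (nthPrime (cnt k + t))))
    (hu : (crossedSet k n i (nthPrime (cnt k + t))).card + u = (crossedSet k n (i + 1) 0).card) :
    Reach sieve w (St 59 [c, 1, 0, k, k !, x5, x6, i, k ! + 1 + t, x9, x10]
      [A, δ, 1 + δ, r3, r4, 0, ((1 : ℕ) : ℝ)] M X) (11 * u + 10)
      (fun s => ∃ X' y5 y6 y8 s3, Marks X' (Crossed k n (i + 1) 0) ∧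
        s = St 42 [c, 1, 0, k, k !, y5, y6, i, y8, x9, x10]
          [A, δ, 1 + δ, s3, r4, 0, ((1 : ℕ) : ℝ)] M X') := by
  induction u using Nat.strong_induction_on generalizing t x5 x6 r3 X with
  | _ u ih =>
  have hqp := nthPrime_prime (cnt k + t)
  have hqk : k < nthPrime (cnt k + t) := (lt_nthPrime_iff _ _).2 (Nat.le_add_right _ _)
  have hqi : nthPrime (cnt k + t) ≤ i := hq.trans (Nat.minFac_le (by omega))
  have htn : t ≤ n := by
    have := mt (lt_nthPrime_iff i (cnt k + t)).2 hqi.not_gt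
    have := cnt_le i
    omega
  have hnext : ∀ p, p.Prime → (p < nthPrime (cnt k + (t + 1)) ↔ p ≤ nthPrime (cnt k + t)) :=
    fun p hp => prime_lt_nthPrime_succ_iff hp (cnt k + t)
  have hMt := hM t hqi
  generalize nthPrime (cnt k + t) = q at *
  have hqi2 : q * i ≤ n * n := Nat.mul_le_mul (hqi.trans hin) hin
  have hnn : n * n + 10 * n + 100 ≤ 1000 * (n + 1) ^ 2 := by nlinarith
  have hdi : i / q ≤ i := Nat.div_le_self _ _
  have hdi2 : i / q * q ≤ i := Nat.div_mul_le_self _ _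
  refine Reach.intLoad q hMt (by omega) ?_
  refine Reach.mul (q * i) (by omega) ?_
  refine Reach.cast (q * i) ?_
  refine Reach.realOp (((q * i : ℕ) : ℝ) * δ) rfl ?_
  by_cases hn : n < q * i
  · refine Reach.realJump_pos ((ht (q * i)).2 hn) (Reach.done ?_)
    -- A number `m ≤ n` with cofactor `i` is `m.minFac * i`, so `q * i > n` forces `m.minFac < q`.
    refine ⟨X, q, q * i, k ! + 1 + t, _, hX.congr (crossed_succ_iff ?_), rfl⟩
    intro m hm hmp hmn hmi
    have := minFac_mul_div m
    rw [hmi] at this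
    by_contra hlt
    have := Nat.mul_le_mul_right i (not_lt.1 hlt)
    omega
  refine Reach.realJump_neg (lt_of_not_ge (mt (ht (q * i)).1 hn)) ?_
  rw [not_lt] at hn
  refine Reach.realStore (q * i) ((1 : ℕ) : ℝ) ?_
  refine Reach.div (i / q) hqp.ne_zero (by omega) ?_
  refine Reach.mul (i / q * q) (by omega) ?_
  have hX' := hX.update (crossed_next_iff hqp hqk hr hi hq hn hnext)
  have hcard := crossedSet_next hqp hqk hr hi hq hn hnext
  have hle := Finset.card_le_card
    (crossedSet_subset_succ (k := k) (n := n) (i := i) (b := nthPrime (cnt k + (t + 1))))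
  obtain ⟨u, rfl⟩ : ∃ v, u = v + 1 := ⟨u - 1, by omega⟩
  have htime : 11 * (u + 1) + 2 = (11 * u + 10) + 3 := by ring
  rw [htime]
  by_cases hd : q ∣ i
  · refine Reach.intJump_pos (le_div_mul_self_iff.2 hd) (Reach.done ?_)
    -- As `q ∣ i`, a number with cofactor `i` has its least prime factor at most `i.minFac ≤ q`.
    refine ⟨_, q, i / q * q, k ! + 1 + t, _, hX'.congr (crossed_succ_iff ?_), rfl⟩
    intro m hm hmp hmn hmi
    rw [hnext _ (Nat.minFac_prime (by omega))]
    exact (minFac_le_minFac_div hm hmp).trans (hmi ▸ Nat.minFac_le_of_dvd hqp.two_le hd)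
  · refine Reach.intJump_neg (not_le.1 (mt le_div_mul_self_iff.1 hd)) ?_
    refine Reach.add (k ! + 1 + (t + 1)) (by omega) ?_
    refine Reach.intJump_pos (le_refl 0) ?_
    refine ih u (by omega) ?_ hX' (by omega)
    rw [← not_lt, hnext _ (Nat.minFac_prime (by omega)), not_le]
    exact lt_of_le_of_ne hq fun h => hd (h ▸ Nat.minFac_dvd i)

theorem Reach.nextCandidate (hB : 1000 * (n + 1) ^ 2 < 2 ^ w)
    {A r3 r4 : ℝ} {M : ℕ → ℕ} {X : ℕ → ℝ} {Q : State → Prop}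
    {k c x5 x6 i g x8 x9 x10 t : ℕ} (hW : k ! ≤ n + 2) (hin : i ≤ n)
    (hM : ∀ y, y ≤ k ! → IsGap k y (M y)) (hg : M (i % k !) = g)
    (h : Reach sieve w (St 49 [c, 1, 0, k, k !, x5, g, i + g, x8, x9, x10]
      [A, δ, 1 + δ, ((i + g : ℕ) : ℝ), ((i + g : ℕ) : ℝ) * δ, 0, ((1 : ℕ) : ℝ)] M X) t Q) :
    Reach sieve w (St 42 [c, 1, 0, k, k !, x5, x6, i, x8, x9, x10]
      [A, δ, 1 + δ, r3, r4, 0, ((1 : ℕ) : ℝ)] M X) (t + 7) Q := by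
  have hpos := Nat.factorial_pos k
  have hnn : n * n + 10 * n + 100 ≤ 1000 * (n + 1) ^ 2 := by nlinarith
  have h1 : i / k ! ≤ i := Nat.div_le_self _ _
  have h2 : i / k ! * k ! ≤ i := Nat.div_mul_le_self _ _
  have h3 : i % k ! ≤ i := Nat.mod_le _ _
  have h4 := (hM (i % k !) (Nat.mod_lt _ hpos).le).le
  refine Reach.div (i / k !) hpos.ne' (by omega) ?_
  refine Reach.mul (i / k ! * k !) (by omega) ?_
  refine Reach.sub (i % k !) (Nat.mod_add_div' i (k !)).symm (by omega) ?_
  refine Reach.intLoad g hg (by omega) ?_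
  refine Reach.add (i + g) (by omega) ?_
  refine Reach.cast (i + g) ?_
  refine Reach.realOp (((i + g : ℕ) : ℝ) * δ) rfl ?_
  exact h

/-- The work on one candidate. -/
theorem Reach.candidate (hB : 1000 * (n + 1) ^ 2 < 2 ^ w)
    (ht : ∀ c : ℕ, 1 + δ ≤ (c : ℝ) * δ ↔ n < c) {r3 r4 : ℝ} {M : ℕ → ℕ} {X : ℕ → ℝ}
    {k x5 x6 i g x8 x10 v u : ℕ} (hW : k ! ≤ n + 2) (hi : 1 ≤ i) (hin : i + g ≤ n)
    (hM : ∀ y, y ≤ k ! → IsGap k y (M y)) (hg : M (i % k !) = g)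
    (hv : cnt k + v = cnt (max i k))
    (hL : ∀ s, s < v → M (k ! + 1 + s) = nthPrime (cnt k + s))
    (hX : Marks X (Crossed k n (i + 1) 0))
    (hu : (crossedSet k n (i + 1) 0).card + u = (crossedSet k n (i + g + 1) 0).card) :
    Reach sieve w (St 42 [cnt (max i k), 1, 0, k, k !, x5, x6, i, x8, k ! + 1 + v, x10]
      [prd (max i k), δ, 1 + δ, r3, r4, 0, ((1 : ℕ) : ℝ)] M X) (11 * u + 27)
      (fun s => ∃ v' M' X' y5 y6 y8 s3 s4, (∀ y, y ≤ k ! → IsGap k y (M' y)) ∧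
        cnt k + v' = cnt (max (i + g) k) ∧
        (∀ s, s < v' → M' (k ! + 1 + s) = nthPrime (cnt k + s)) ∧
        Marks X' (Crossed k n (i + g + 1) 0) ∧
        s = St 42 [cnt (max (i + g) k), 1, 0, k, k !, y5, y6, i + g, y8, k ! + 1 + v', x10]
          [prd (max (i + g) k), δ, 1 + δ, s3, s4, 0, ((1 : ℕ) : ℝ)] M' X') := by
  have hpos := Nat.factorial_pos k
  have hgap : IsGap k i g := IsGap.of_mod (hg ▸ hM _ (Nat.mod_lt _ hpos).le)
  have hg1 := hgap.1
  have hlt := hgap.lt_add hi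
  have hmax : max (i + g) k = i + g := max_eq_left (by have := le_max_right i k; omega)
  have hnn : n * n + 10 * n + 100 ≤ 1000 * (n + 1) ^ 2 := by nlinarith
  have hcle := cnt_le (max i k)
  have hcross := fun t => hgap.crossed_iff (n := n) (b := nthPrime (cnt k + t))
  have hprime : ∀ p, p.Prime → k < p → nthPrime (cnt k + 0) ≤ p := fun p hp hk =>
    nthPrime_cnt_le hp hk
  have hcard := crossedSet_congr (hcross 0 hprime)
  have hmf := hprime _ (Nat.minFac_prime (n := i + g) (by omega))
    (hgap.2.1.lt_minFac (by omega))
  refine Reach.nextCandidate (t := 11 * u + 20) hB hW (by omega) hM hg ?_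
  refine Reach.realJump_neg (lt_of_not_ge (mt (ht (i + g)).1 (by omega))) ?_
  refine Reach.realLoad (X (i + g)) rfl ?_
  have hfinish : ∀ {v' M' s3 s4}, (∀ y, y ≤ k ! → IsGap k y (M' y)) →
      cnt k + v' = cnt (max (i + g) k) →
      (∀ s, s < v' → M' (k ! + 1 + s) = nthPrime (cnt k + s)) →
      Reach sieve w
        (St 58 [cnt (max (i + g) k), 1, 0, k, k !, x5, g, i + g, x8, k ! + 1 + v', x10]
        [prd (max (i + g) k), δ, 1 + δ, s3, s4, 0, ((1 : ℕ) : ℝ)] M' X) (11 * u + 11)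
        (fun s => ∃ v' M' X' y5 y6 y8 s3 s4, (∀ y, y ≤ k ! → IsGap k y (M' y)) ∧
        cnt k + v' = cnt (max (i + g) k) ∧
        (∀ s, s < v' → M' (k ! + 1 + s) = nthPrime (cnt k + s)) ∧
        Marks X' (Crossed k n (i + g + 1) 0) ∧
        s = St 42 [cnt (max (i + g) k), 1, 0, k, k !, y5, y6, i + g, y8, k ! + 1 + v', x10]
          [prd (max (i + g) k), δ, 1 + δ, s3, s4, 0, ((1 : ℕ) : ℝ)] M' X') := by
    intro v' M' s3 s4 hM' hv' hL'
    refine Reach.add (k ! + 1 + 0) (by omega) ?_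
    have hM'' : ∀ s, nthPrime (cnt k + s) ≤ i + g → M' (k ! + 1 + s) = nthPrime (cnt k + s) := by
      intro s hs
      refine hL' s ?_
      have := mt (lt_nthPrime_iff (i + g) (cnt k + s)).2 hs.not_gt
      rw [hmax] at hv'
      omega
    refine (Reach.trans (u := 0) (Reach.crossOut hB ht hW (by omega) hin hgap.2.1 hM'' hmf
      (hX.congr (hcross 0 hprime)) (by rw [← hcard]; exact hu)) ?_)
    rintro s ⟨X', y5, y6, y8, s3, hX', rfl⟩
    exact Reach.done ⟨v', M', X', y5, y6, y8, s3, s4, hM', hv', hL', hX', rfl⟩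
  -- A prime candidate joins the list before its multiples are crossed out, because its square is
  -- among them.
  by_cases hp : (i + g).Prime
  · obtain ⟨hc1, hc2, hc3⟩ := hgap.cnt_of_prime hi hp
    have hc3' : prd (max (i + g) k) =
        prd (max i k) * (((i + g : ℕ) : ℝ) / (((i + g : ℕ) : ℝ) - ((1 : ℕ) : ℝ))) := by
      rw [hc3, Nat.cast_one]
    have hx0 : X (i + g) = 0 :=
      ((hX (i + g)).resolve_left fun h => h.1.2.1 hp).2
    have hne : ((i + g : ℕ) : ℝ) - ((1 : ℕ) : ℝ) ≠ 0 := by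
      rw [sub_ne_zero]
      exact_mod_cast hp.one_lt.ne'
    refine Reach.realJump_neg (show X (i + g) < ((1 : ℕ) : ℝ) by rw [hx0]; simp) ?_
    refine Reach.intStore (k ! + 1 + v) (i + g) ?_
    refine Reach.add (k ! + 1 + (v + 1)) (by omega) ?_
    refine Reach.realOp (((i + g : ℕ) : ℝ) - ((1 : ℕ) : ℝ)) rfl ?_
    refine Reach.realDiv (((i + g : ℕ) : ℝ) / (((i + g : ℕ) : ℝ) - ((1 : ℕ) : ℝ))) hne ?_
    refine Reach.realOp
      (prd (max i k) * (((i + g : ℕ) : ℝ) / (((i + g : ℕ) : ℝ) - ((1 : ℕ) : ℝ)))) rfl ?_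
    refine Reach.add (cnt (max i k) + 1) (by omega) ?_
    have h := hfinish (v' := v + 1) (M' := Function.update M (k ! + 1 + v) (i + g))
      (s3 := ((i + g : ℕ) : ℝ) / (((i + g : ℕ) : ℝ) - ((1 : ℕ) : ℝ)))
      (s4 := ((i + g : ℕ) : ℝ) - ((1 : ℕ) : ℝ)) ?_ (by omega) ?_
    · rw [hc1, hc3'] at h ⊢
      exact h
    · intro y hy
      rw [Function.update_of_ne (by omega)]
      exact hM y hy
    · intro s hs
      by_cases hsv : s = v
      · rw [hsv, Function.update_self, hv, hc2]
      · rw [Function.update_of_ne (by omega)]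
        exact hL s (by omega)
  · have hc1 := hgap.cnt_of_not_prime hi hp
    have hx1 : X (i + g) = 1 :=
      ((hX (i + g)).resolve_right fun h => h.1 ((hgap.crossed_candidate_iff hi hin).2 hp)).2
    refine Reach.realJump_pos (show ((1 : ℕ) : ℝ) ≤ X (i + g) by rw [hx1]; simp) ?_
    have h := hfinish (v' := v) (M' := M) (s3 := ((i + g : ℕ) : ℝ)) (s4 := X (i + g)) hM
      (by rw [hv, hc1]) hL
    rw [prd_congr hc1, hc1] at h ⊢
    exact Reach.mono_time (t := 11 * u + 11) h (by omega)

/-- Amortization: `u` bounds all crossings still to come and the rough numbers in `(i, n]` bound the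
candidates, so the costs of the single candidates add up to this linear expression. -/
theorem Reach.sieving (hB : 1000 * (n + 1) ^ 2 < 2 ^ w)
    (ht : ∀ c : ℕ, 1 + δ ≤ (c : ℝ) * δ ↔ n < c) {r3 r4 : ℝ} {M : ℕ → ℕ} {X : ℕ → ℝ}
    {k x5 x6 i x8 x10 v u : ℕ} (hW : k ! ≤ n + 2) (hi : 1 ≤ i) (hin : i ≤ n)
    (hM : ∀ y, y ≤ k ! → IsGap k y (M y)) (hv : cnt k + v = cnt (max i k))
    (hL : ∀ s, s < v → M (k ! + 1 + s) = nthPrime (cnt k + s))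
    (hX : Marks X (Crossed k n (i + 1) 0))
    (hu : (crossedSet k n (i + 1) 0).card + u = (roughSet k n 0).card) :
    Reach sieve w (St 42 [cnt (max i k), 1, 0, k, k !, x5, x6, i, x8, k ! + 1 + v, x10]
      [prd (max i k), δ, 1 + δ, r3, r4, 0, ((1 : ℕ) : ℝ)] M X)
      (11 * u + 27 * (roughSet k n i).card + 8)
      (fun s => ∃ M' X' y5 y6 y7 y8 y9 s3 s4,
        s = St 70 [cnt (max n k), 1, 0, k, k !, y5, y6, y7, y8, y9, x10]
          [prd (max n k), δ, 1 + δ, s3, s4, 0, ((1 : ℕ) : ℝ)] M' X') := by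
  have hpos := Nat.factorial_pos k
  obtain ⟨g, hg⟩ : ∃ g, M (i % k !) = g := ⟨_, rfl⟩
  have hgap : IsGap k i g := IsGap.of_mod (hg ▸ hM _ (Nat.mod_lt _ hpos).le)
  have hg1 := hgap.1
  have hlt := hgap.lt_add hi
  by_cases hn : n < i + g
  · refine Reach.nextCandidate (t := 11 * u + 27 * (roughSet k n i).card + 1)
      hB hW hin hM hg ?_
    have hc := hgap.cnt_eq (x := max n k) (by omega) (by omega)
    rw [hc, prd_congr hc]
    exact Reach.realJump_pos ((ht (i + g)).2 hn) (Reach.done ⟨_, _, _, _, _, _, _, _, _, rfl⟩)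
  · rw [not_lt] at hn
    have hmono : (crossedSet k n (i + 1) 0).card ≤ (crossedSet k n (i + g + 1) 0).card := by
      rw [crossedSet_congr (hgap.crossed_iff (b := 0) fun _ _ _ => Nat.zero_le _)]
      exact Finset.card_le_card crossedSet_subset_succ
    have htot := Finset.card_le_card (crossedSet_subset (k := k) (n := n) (i := i + g + 1) (b := 0))
    have hrough := hgap.roughSet_card hn
    obtain ⟨u1, hu1⟩ := Nat.le.dest hmono
    obtain ⟨u2, hu2⟩ := Nat.le.dest htot
    have htime : (11 * u1 + 27) + (11 * u2 + 27 * (roughSet k n (i + g)).card + 8) ≤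
        11 * u + 27 * (roughSet k n i).card + 8 := by omega
    refine Reach.mono_time ?_ htime
    refine Reach.trans (u := 11 * u2 + 27 * (roughSet k n (i + g)).card + 8)
      (Reach.candidate hB ht hW hi hn hM hg hv hL hX hu1) ?_
    rintro s ⟨v', M', X', y5, y6, y8, s3, s4, hM', hv', hL', hX', rfl⟩
    exact Reach.sieving hB ht hW (by omega) hn hM' hv' hL' hX' hu2
termination_by n - i

/-- The whole run of the program. -/
theorem Reach.total (hB : 1000 * (n + 1) ^ 2 < 2 ^ w) (hn : 1 ≤ n)
    (ht : ∀ c : ℕ, 1 + δ ≤ (c : ℝ) * δ ↔ n < c) :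
    ∃ k, 2 ≤ k ∧ (k = 2 ∨ k ! ^ 3 ≤ n) ∧ n < (k + 1) ! ^ 3 ∧
      Reach sieve w (init δ) (28 * k ! ^ 2 + 38 * (roughSet k n 0).card + 27)
      (fun s => sieve[s.pc]? = some Instr.halt ∧
        s.intReg 0 = (cnt (max n 2) : ℤ) - 2 ∧ s.realReg 0 = prd (max n 2)) := by
  obtain ⟨k, hk2, hk, hkn, hsearch⟩ := Reach.search (w := w) (A := ((1 : ℕ) : ℝ)) (r3 := 0) (r4 := 0)
    (M := fun _ => 0) (X := fun _ => 0) (x5 := 0) (x6 := 0) (x7 := 0) hB ht le_rfl (Or.inl rfl)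
  have hself := Nat.self_le_factorial k
  have hpos := Nat.factorial_pos k
  have hpow := Nat.le_self_pow (n := 3) (by decide) (k !)
  have hW : k ! ≤ n + 2 := by
    rcases hk with rfl | hk
    · exact Nat.le_add_left _ _
    · omega
  have hkn2 : k ≤ max n 2 := by
    rcases hk with rfl | hk
    · exact le_max_right _ _
    · exact le_max_of_le_left (by omega)
  have hnn : n * n + 10 * n + 100 ≤ 1000 * (n + 1) ^ 2 := by nlinarith
  refine ⟨k, hk2, hk, hkn, ?_⟩
  have hsq : k * k ! ≤ k ! ^ 2 := by rw [pow_two]; exact Nat.mul_le_mul_right _ hself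
  have hsq2 : 2 * k ! ≤ k ! ^ 2 := (Nat.mul_le_mul_right _ hk2).trans hsq
  have hsq3 : k ≤ k ! ^ 2 := by nlinarith
  have htime : (10 * (k - 2) + 7) + ((k ! * (6 * k + 12) + 3) +
      ((11 * (roughSet k n 0).card + 27 * (roughSet k n 1).card + 8) + 2 + 2)) + 7 ≤
      28 * k ! ^ 2 + 38 * (roughSet k n 0).card + 27 := by
    have h1 : k ! * (6 * k + 12) = 6 * (k * k !) + 6 * (2 * k !) := by ring
    have h2 := Finset.card_le_card (roughSet_subset (k := k) (n := n) (i := 1))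
    omega
  -- For `n ≤ 1` the search stops at `k = 2`, so the prime 2 is counted even then, as the bound `L ≥
  -- -1` requires.
  have hmax : max n k = max n 2 := by omega
  refine Reach.mono_time (Reach.start hB (Reach.trans hsearch ?_)) htime
  rintro s ⟨y6, y7, s3, rfl⟩
  refine Reach.trans (Reach.gaps hk2 (by omega)) ?_
  rintro s ⟨M, y6, y8, y10, s3, s4, hM, rfl⟩
  refine Reach.add (k ! + 1) (by omega) ?_
  refine Reach.add 1 (by omega) ?_
  have hmax1 : max 1 k = k := by omega
  have hempty : (crossedSet k n 2 0).card = 0 := by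
    rw [Finset.card_eq_zero, Finset.eq_empty_iff_forall_notMem]
    exact fun c hc => not_crossed_two_zero (mem_crossedSet.1 hc)
  have hsieve := Reach.sieving (r3 := s3) (r4 := s4) (M := M) (X := fun _ => 0) (x5 := k + 1)
    (x6 := y6) (i := 1) (x8 := y8) (x10 := y10) (v := 0) hB ht hW le_rfl hn hM (by rw [hmax1]; rfl)
    (fun s hs => absurd hs (Nat.not_lt_zero s)) (fun c => Or.inr ⟨not_crossed_two_zero, rfl⟩)
    (by rw [hempty, zero_add])
  rw [hmax1, hmax] at hsieve
  refine Reach.trans (u := 2) hsieve ?_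
  rintro s ⟨M', X', y5, y6, y7, y8, y9, s3, s4, rfl⟩
  have hcnt := cnt_le (max n 2)
  refine Reach.const 2 (by omega) ?_
  have habs : |((cnt (max n 2) : ℕ) : ℤ) - ((2 : ℕ) : ℤ)| < 2 ^ w := by
    have h2w : ((n + 3 : ℕ) : ℤ) < 2 ^ w := by exact_mod_cast (by omega : n + 3 < 2 ^ w)
    rw [abs_lt]
    constructor <;> omega
  refine Reach.sub_last (x := cnt (max n 2)) (y := 2) habs ?_
  exact Reach.done ⟨rfl, by simp, rfl⟩

end Runs

/-! ### The density of the rough numbers and the time bound. -/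

theorem Rough.coprime_factorial {k x : ℕ} (h : Rough k x) : Nat.Coprime (k !) x :=
  Nat.Coprime.symm (Nat.coprime_of_dvd fun p hp hx hk =>
    h p hp.two_le (hp.dvd_factorial.1 hk) hx)

theorem card_roughSet_le (k n : ℕ) : (roughSet k n 0).card ≤ φ (k !) * (n / k ! + 1) := by
  refine le_trans (Finset.card_le_card fun c hc => ?_)
    (Nat.Ico_filter_coprime_le 1 n (Nat.factorial_ne_zero k))
  simp only [roughSet, Finset.mem_filter, Finset.mem_Ioc] at hc
  rw [Finset.mem_filter, Finset.mem_Ico]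
  exact ⟨by omega, hc.2.coprime_factorial⟩

theorem primeFactors_factorial (k : ℕ) :
    (k !).primeFactors = (Finset.range (k + 1)).filter Nat.Prime := by
  ext p
  simp only [Nat.mem_primeFactors, Finset.mem_filter, Finset.mem_range]
  constructor
  · rintro ⟨hp, hd, -⟩
    exact ⟨Nat.lt_succ_of_le (hp.dvd_factorial.1 hd), hp⟩
  · rintro ⟨hk, hp⟩
    exact ⟨hp, hp.dvd_factorial.2 (by omega), Nat.factorial_ne_zero k⟩

theorem totient_factorial_div (k : ℕ) :
    (φ (k !) : ℝ) / (k ! : ℝ) = ∏ p ∈ (Finset.range (k + 1)).filter Nat.Prime, (1 - (p : ℝ)⁻¹) := by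
  have h := Nat.totient_eq_mul_prod_factors (k !)
  rw [primeFactors_factorial] at h
  have h' : ((φ (k !) : ℚ) : ℝ) = (((k ! : ℚ) *
    ∏ p ∈ (Finset.range (k + 1)).filter Nat.Prime, (1 - (p : ℚ)⁻¹) : ℚ) : ℝ) := by rw [h]
  push_cast at h'
  rw [h', mul_div_cancel_left₀]
  exact_mod_cast Nat.factorial_ne_zero k

/-- The factors satisfy `1 - 1/p ≤ exp (-1/p)`, so the ratio is at most `exp` of minus the sum of
`1/p` over `p ≤ k`, and that sum diverges. -/
theorem tendsto_totient_factorial_div :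
    Tendsto (fun k : ℕ => (φ (k !) : ℝ) / (k ! : ℝ)) atTop (𝓝 0) := by
  have hsum := (not_summable_iff_tendsto_nat_atTop_of_nonneg (fun n => by
    apply Set.indicator_nonneg; intro m _; positivity)).1 not_summable_one_div_on_primes
  have hexp := Real.tendsto_exp_neg_atTop_nhds_zero.comp (hsum.comp (tendsto_add_atTop_nat 1))
  refine squeeze_zero (fun k => by positivity) (fun k => ?_) hexp
  rw [totient_factorial_div, Function.comp_apply, Function.comp_apply, ← Finset.sum_neg_distrib,
    Real.exp_sum, Finset.prod_filter]
  refine Finset.prod_le_prod (fun p _ => ?_) (fun p _ => ?_)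
  · split_ifs with hp
    · exact sub_nonneg.2 (Nat.cast_inv_le_one p)
    · exact zero_le_one
  · by_cases hp : p.Prime
    · rw [if_pos hp, Set.indicator_of_mem (by exact hp), one_div]
      linarith [Real.add_one_le_exp (-(p : ℝ)⁻¹)]
    · rw [if_neg hp, Set.indicator_of_notMem (by exact hp), neg_zero, Real.exp_zero]

/-- From `k * k!^2 ≤ k!^3 ≤ n`, both `k!^2` and `1` are at most `n / k`, whence `55 = 28 + 27`. In
`76 = 2 * 38` the factor 2 absorbs the incomplete last period of length `k!`. -/
theorem time_le {k n : ℕ} (hk : 3 ≤ k) (hkn : k ! ^ 3 ≤ n) :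
    ((28 * k ! ^ 2 + 38 * (roughSet k n 0).card + 27 : ℕ) : ℝ) ≤
      (55 * ((1 : ℝ) / k) + 76 * ((φ (k !) : ℝ) / (k ! : ℝ))) * n := by
  have hk0 : (0 : ℝ) < k := by exact_mod_cast (by omega : 0 < k)
  have hW : (k : ℝ) ≤ (k ! : ℝ) := by exact_mod_cast Nat.self_le_factorial k
  have hW1 : (1 : ℝ) ≤ (k ! : ℝ) := by exact_mod_cast Nat.factorial_pos k
  have hn : (k ! : ℝ) ^ 3 ≤ n := by exact_mod_cast hkn
  have h1 : (k ! : ℝ) ^ 2 ≤ 1 / k * n := by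
    rw [div_mul_eq_mul_div, one_mul, le_div_iff₀ hk0]
    calc (k ! : ℝ) ^ 2 * k ≤ (k ! : ℝ) ^ 2 * k ! := by gcongr
      _ = (k ! : ℝ) ^ 3 := by ring
      _ ≤ n := hn
  have h2 : (1 : ℝ) ≤ 1 / k * n := (one_le_pow₀ hW1).trans h1
  have hWn : (k ! : ℝ) ≤ n := (le_self_pow₀ hW1 (by norm_num)).trans hn
  have h3 : ((roughSet k n 0).card : ℝ) ≤ 2 * ((φ (k !) : ℝ) / (k ! : ℝ)) * n := by
    have h := card_roughSet_le k n
    have h' : ((roughSet k n 0).card : ℝ) ≤ (φ (k !) : ℝ) * (((n / k ! : ℕ) : ℝ) + 1) := by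
      exact_mod_cast h
    refine h'.trans ?_
    have hd : ((n / k ! : ℕ) : ℝ) + 1 ≤ 2 * ((n : ℝ) / (k ! : ℝ)) := by
      have := Nat.cast_div_le (α := ℝ) (m := n) (n := k !)
      have : 1 ≤ (n : ℝ) / (k ! : ℝ) := (one_le_div (by linarith)).2 hWn
      linarith
    calc (φ (k !) : ℝ) * (((n / k ! : ℕ) : ℝ) + 1) ≤ (φ (k !) : ℝ) * (2 * ((n : ℝ) / (k ! : ℝ))) := by
          gcongr
      _ = 2 * ((φ (k !) : ℝ) / (k ! : ℝ)) * n := by ring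
  push_cast
  linarith

theorem exists_time_le {ε : ℝ} (hε : 0 < ε) : ∃ N : ℕ, ∀ n ≥ N, ∀ k, (k = 2 ∨ k ! ^ 3 ≤ n) →
    n < (k + 1) ! ^ 3 →
    ((28 * k ! ^ 2 + 38 * (roughSet k n 0).card + 27 : ℕ) : ℝ) ≤ ε * n := by
  have hlim : Tendsto (fun k : ℕ => 55 * ((1 : ℝ) / k) + 76 * ((φ (k !) : ℝ) / (k ! : ℝ)))
      atTop (𝓝 0) := by
    have := (tendsto_one_div_atTop_nhds_zero_nat (𝕜 := ℝ)).const_mul 55 |>.add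
      (tendsto_totient_factorial_div.const_mul 76)
    simpa using this
  obtain ⟨K, hK⟩ := eventually_atTop.1 (hlim.eventually (gt_mem_nhds hε))
  -- Beyond this threshold, `n < (k + 1)!^3` forces `k ≥ max K 3`.
  refine ⟨(max K 3) ! ^ 3, fun n hn k hk hkn => ?_⟩
  have hlt : max K 3 < k + 1 := by
    by_contra hle
    have := Nat.pow_le_pow_left (Nat.factorial_le (not_lt.1 hle)) 3
    omega
  have hk3 : 3 ≤ k := by omega
  refine (time_le hk3 (hk.resolve_left (by omega))).trans ?_
  exact mul_le_mul_of_nonneg_right (hK k (by omega)).le (Nat.cast_nonneg n)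

/-! ### The output is the required one; bounds in terms of `δ`. -/

theorem admissible_iff {δ : ℝ} {n : ℕ} (ht : ∀ c : ℕ, 1 + δ ≤ (c : ℝ) * δ ↔ n < c) (t : ℕ) :
    (nthPrime t : ℝ) / ((nthPrime t : ℝ) - 1) ≤ 1 + δ ↔ n < nthPrime t := by
  have hp : (1 : ℝ) < nthPrime t := by exact_mod_cast (nthPrime_prime t).one_lt
  rw [← ht, div_le_iff₀ (by linarith)]
  constructor <;> intro h <;> linarith

theorem isLeast_admissible {δ : ℝ} {n : ℕ} (ht : ∀ c : ℕ, 1 + δ ≤ (c : ℝ) * δ ↔ n < c) :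
    IsLeast (admissibleIndices δ) ((cnt (max n 2) : ℤ) - 2) := by
  have h2 : cnt 2 ≤ cnt (max n 2) := cnt_mono (le_max_right _ _)
  have hc2 : 1 ≤ cnt 2 := by
    rw [cnt_succ_of_prime Nat.prime_two]; omega
  constructor
  · refine ⟨by omega, ?_⟩
    rw [admissible_iff ht]
    have : ((cnt (max n 2) : ℤ) - 2 + 2).toNat = cnt (max n 2) := by omega
    rw [this]
    exact lt_of_le_of_lt (le_max_left n 2) ((lt_nthPrime_iff _ _).2 le_rfl)
  · rintro L ⟨hL, h⟩
    rw [admissible_iff ht] at h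
    -- `L ≥ -1` makes the index at least one, so this prime exceeds 2 as well as `n`.
    have h3 : 2 < nthPrime (L + 2).toNat := by
      have h0 : nthPrime 0 < nthPrime (L + 2).toNat := nthPrime_lt_iff.2 (by omega)
      exact lt_of_le_of_lt (nthPrime_prime 0).two_le h0
    have := (lt_nthPrime_iff _ _).1 (max_lt h h3)
    omega

theorem Psi_cnt (m : ℕ) : Psi ((cnt m : ℤ) - 2) = prd m := by
  rw [Psi, prd]
  congr 2
  omega

theorem one_add_le_mul_iff {δ : ℝ} (hδ : 0 < δ) (c : ℕ) :
    1 + δ ≤ (c : ℝ) * δ ↔ ⌈1 / δ⌉₊ < c := by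
  rcases c with _ | c
  · simp only [Nat.cast_zero, zero_mul, _root_.not_lt_zero, iff_false, not_le]
    linarith
  · rw [Nat.lt_succ_iff, Nat.ceil_le, div_le_iff₀ hδ]
    push_cast
    constructor <;> intro h <;> linarith

/-- The quadratic size covers products such as `q * i` with `q, i ≤ n`, and the cube tested in the
search for `k`. -/
theorem word_size_bound (n : ℕ) : 1000 * (n + 1) ^ 2 < 2 ^ (2 * Nat.log 2 n + 12) := by
  have h : n + 1 ≤ 2 ^ (Nat.log 2 n + 1) := Nat.lt_pow_succ_log_self (by norm_num) n
  have h2 : (n + 1) ^ 2 ≤ (2 ^ (Nat.log 2 n + 1)) ^ 2 := Nat.pow_le_pow_left h 2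
  have hpos : 1 ≤ (n + 1) ^ 2 := Nat.one_le_pow _ _ (by omega)
  have h3 : 2 ^ (2 * Nat.log 2 n + 12) = 1024 * (2 ^ (Nat.log 2 n + 1)) ^ 2 := by ring
  omega

theorem ceil_one_div_le {δ : ℝ} (hδ : 0 < δ) (h1 : δ ≤ 1) : (⌈1 / δ⌉₊ : ℝ) ≤ 2 * (1 / δ) := by
  have h := (Nat.ceil_lt_add_one (one_div_pos.2 hδ).le).le
  have : 1 ≤ 1 / δ := (one_le_div hδ).2 h1
  linarith

theorem word_size_isBigO :
    (fun δ : ℝ => ((2 * Nat.log 2 ⌈1 / δ⌉₊ + 12 : ℕ) : ℝ)) =O[𝓝[>] (0 : ℝ)]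
      fun δ : ℝ => Real.log (1 / δ) := by
  -- For `δ < exp (-1)` put `ℓ = log (1/δ) ≥ 1`; the word size is at most `4 * (1 + ℓ) + 12 ≤ 20 *
  -- ℓ`.
  refine IsBigO.of_bound 20 ?_
  have hmem : Set.Ioo (0 : ℝ) (Real.exp (-1)) ∈ 𝓝[>] (0 : ℝ) :=
    Ioo_mem_nhdsGT (Real.exp_pos _)
  filter_upwards [hmem] with δ hδ
  have hlog : 1 ≤ Real.log (1 / δ) := by
    rw [one_div, Real.log_inv]
    have := (Real.log_lt_iff_lt_exp hδ.1).2 hδ.2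
    linarith
  have hδ1 : δ ≤ 1 := hδ.2.le.trans (Real.exp_le_one_iff.2 (by norm_num))
  have hn : (0 : ℝ) < (⌈1 / δ⌉₊ : ℝ) := by
    exact_mod_cast Nat.ceil_pos.2 (one_div_pos.2 hδ.1)
  have h1 : (Nat.log 2 ⌈1 / δ⌉₊ : ℝ) ≤ Real.logb 2 (⌈1 / δ⌉₊ : ℝ) := by
    exact_mod_cast Real.natLog_le_logb ⌈1 / δ⌉₊ 2
  have h2 : Real.log (⌈1 / δ⌉₊ : ℝ) ≤ Real.log 2 + Real.log (1 / δ) := by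
    rw [← Real.log_mul (by norm_num) (one_div_pos.2 hδ.1).ne']
    exact Real.log_le_log hn (ceil_one_div_le hδ.1 hδ1)
  have hl2 := Real.log_two_gt_d9
  have hl2' := Real.log_two_lt_d9
  have h3 : Real.logb 2 (⌈1 / δ⌉₊ : ℝ) ≤ 2 * (1 + Real.log (1 / δ)) := by
    rw [Real.logb, div_le_iff₀ (by linarith)]
    nlinarith
  rw [Real.norm_of_nonneg (by positivity), Real.norm_of_nonneg (by linarith)]
  push_cast
  linarith

end RealRAM

theorem mainTheorem7 :
    ∃ (P : RealRAM.Program) (w T : ℝ → ℕ),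
      ((fun δ : ℝ => (w δ : ℝ)) =O[𝓝[>] (0 : ℝ)] fun δ : ℝ => Real.log (1 / δ)) ∧
      ((fun δ : ℝ => (T δ : ℝ)) =o[𝓝[>] (0 : ℝ)] fun δ : ℝ => 1 / δ) ∧
      ∀ δ : ℝ, 0 < δ →
        ∃ L : ℤ, IsLeast (admissibleIndices δ) L ∧
          RealRAM.ComputesWithin P (w δ) (T δ) δ L (Psi L) := by
  have hrun := fun (δ : ℝ) (hδ : 0 < δ) => RealRAM.Reach.total (n := ⌈1 / δ⌉₊)
    (RealRAM.word_size_bound ⌈1 / δ⌉₊) (Nat.succ_le_of_lt (Nat.ceil_pos.2 (one_div_pos.2 hδ)))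
    (RealRAM.one_add_le_mul_iff hδ)
  choose! k _ hk hkn hreach using hrun
  refine ⟨RealRAM.sieve, fun δ => 2 * Nat.log 2 ⌈1 / δ⌉₊ + 12,
    fun δ => 28 * (k δ).factorial ^ 2 + 38 * (RealRAM.roughSet (k δ) ⌈1 / δ⌉₊ 0).card + 27,
    RealRAM.word_size_isBigO, ?_, ?_⟩
  · refine isLittleO_iff.2 fun ε hε => ?_
    -- Half of `ε`, because `⌈1/δ⌉ ≤ 2/δ` for `δ ≤ 1`.
    obtain ⟨N, hN⟩ := RealRAM.exists_time_le (half_pos hε)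
    have hpos : (0 : ℝ) < min 1 (1 / ((N : ℝ) + 1)) := by positivity
    filter_upwards [Ioo_mem_nhdsGT hpos] with δ hδ
    have hδ1 : δ ≤ 1 := hδ.2.le.trans (min_le_left _ _)
    have hNδ : N ≤ ⌈1 / δ⌉₊ := by
      have h1 : (N : ℝ) + 1 ≤ 1 / δ := by
        rw [le_one_div (by positivity) hδ.1]
        exact hδ.2.le.trans (min_le_right _ _)
      have h2 := Nat.le_ceil (1 / δ)
      exact_mod_cast (by linarith : (N : ℝ) ≤ (⌈1 / δ⌉₊ : ℝ))
    have h := hN _ hNδ (k δ) (hk δ hδ.1) (hkn δ hδ.1)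
    have hc := RealRAM.ceil_one_div_le hδ.1 hδ1
    rw [Real.norm_of_nonneg (Nat.cast_nonneg _),
      Real.norm_of_nonneg (one_div_pos.2 hδ.1).le]
    refine h.trans ?_
    calc ε / 2 * (⌈1 / δ⌉₊ : ℝ) ≤ ε / 2 * (2 * (1 / δ)) := by gcongr
      _ = ε * (1 / δ) := by ring
  · intro δ hδ
    refine ⟨_, RealRAM.isLeast_admissible (RealRAM.one_add_le_mul_iff hδ), ?_⟩
    obtain ⟨m, hm, s, hs, h1, h2, h3⟩ := hreach δ hδ
    exact ⟨m, hm, s, hs, h1, h2, by rw [h3, RealRAM.Psi_cnt]⟩
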